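/- Let $q$ be a power of an odd prime $p$, let $m=2\ell>3$ be an even integer, let $e\ge 1$ be an integer such that $m/\gcd(m,e)$ is even, and let $\mathrm{Tr}$ be the trace from $\mathbb F_{q^m}$ to $\mathbb F_q$. Put $\epsilon=0$ if $\ell/\gcd(m,e)$ is odd and $\epsilon=\gcd(m,e)$ if it is even, and let $m_p\in\mathbb F_p\subseteq\mathbb F_q$ be the residue of $m$ modulo $p$. Assume that $m>2\epsilon+2$ if $m_p\ne0$. Let $\eta_1$ be the quadratic character of $\mathbb F_q$, with $\eta_1(0)=0$. Let $u\in\mathbb F_q$, $v\in\mathbb F_q^*$, $$D_1=\{x\in\mathbb F_{q^m}^*:\mathrm{Tr}(x^{q^e+1})=u,\ \mathrm{Tr}(x)=v\},\qquad \mathcal C_{D_1}=\{(\mathrm{Tr}(bx))_{x\in D_1}: b\in\mathbb F_{q^m}\},$$ and write $\eta=\eta_1(v^2-um_p)$. A code is called $t$-weight if exactly $t$ nonzero numbers occur as Hamming weights of its codewords. In the tables below, if two rows have the same weight, their frequencies are to be added. 1) If $v^2-um_p\ne0$ and $m_p\ne0$, then $\mathcal C_{D_1}$ is a linear code over $\mathbb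 F_q$ of length $q^{m-2}-q^{\ell+\epsilon-1}\eta$ and dimension $m$ with the weight distribution $$\begin{array}{cc} \text{Weight}&\text{Frequency}\\ \hline 0&1\\ (q-1)q^{m-3}&q^{m-2\epsilon-2}-1\\ (q-1)q^{m-3}-q^{\ell+\epsilon-2}\eta&(q-1)(q^{m-2\epsilon-2}-q^{\ell-\epsilon-1}\eta)\\ (q-1)q^{m-3}-q^{\ell+\epsilon-1}\eta&(q-1)(q^{m-2\epsilon-2}-1)\\ q^{m-2}-q^{\ell+\epsilon-1}\eta&q-1\\ (q-1)q^{m-3}-q^{\ell+\epsilon-1}\eta+q^{\ell+\epsilon-2}&\frac{q-1}{2}\big((\eta-1)(q^{\ell-\epsilon-1}+q^{m-2\epsilon-2})+q^{\ell-\epsilon}\big)+\frac12\big(q^m(\eta+1)-q^{m-2\epsilon-1}-q^{m-2\epsilon}\eta\big)\\ (q-1)q^{m-3}-q^{\ell+\epsilon-1}\eta-q^{\ell+\epsilon-2}&\frac{q-1}{2}\big((\eta+1)(q^{\ell-\epsilon-1}-q^{m-2\epsilon-2})-q^{\ell-\epsilon}\big)+\frac12\big(q^m(1-\eta)+q^{m-2\epsilon}\eta-q^{m-2\epsilon-1}\big)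 \end{array}$$ Its minimum distance is $(q-1)q^{m-3}-q^{\ell+\epsilon-1}-q^{\ell+\epsilon-2}$ if $\eta=1$ and $(q-1)q^{m-3}$ if $\eta=-1$. It is a $6$-weight code, except when $\ell=\epsilon+2$ and $\eta=1$; in that case the weights $(q-1)q^{m-3}$ and $q^{m-2}-q^{\ell+\epsilon-1}\eta$ coincide and it is a $5$-weight code. 2) If $m_p=0$, then $\mathcal C_{D_1}$ is a $4$-weight linear code over $\mathbb F_q$ of length $q^{m-2}$, dimension $m$ and minimum distance $(q-1)q^{m-3}-q^{\ell+\epsilon-2}$ with the weight distribution $$\begin{array}{cc} \text{Weight}&\text{Frequency}\\ \hline 0&1\\ (q-1)q^{m-3}&q^m-q^{m-2\epsilon}+q^{m-2\epsilon-1}-q\\ q^{m-2}&q-1\\ (q-1)q^{m-3}-q^{\ell+\epsilon-2}&(q-1)(q^{m-2\epsilon-1}-q^{m-2\epsilon-2})\\ (q-1)(q^{m-3}+q^{\ell+\epsilon-2})&(q-1)q^{m-2\epsilon-2} \end{array}$$ 3) If $v^2-um_p=0$, then $\mathcal C_{D_1}$ is a $6$-weight linear code over $\mathbb F_q$ of length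 $q^{m-2}$, dimension $m$ and minimum distance $(q-1)(q^{m-3}-q^{\ell+\epsilon-2})$ with the weight distribution $$\begin{array}{cc} \text{Weight}&\text{Frequency}\\ \hline 0&1\\ (q-1)q^{m-3}&q^m-q^{m-2\epsilon}+q^{m-2\epsilon-1}-q\\ (q-1)q^{m-3}-q^{\ell+\epsilon-2}&\frac{(q-1)^2}{2}(q^{m-2\epsilon-2}-q^{\ell-\epsilon-1})\\ (q-1)q^{m-3}+q^{\ell+\epsilon-2}&\frac{(q-1)^2}{2}(q^{m-2\epsilon-2}+q^{\ell-\epsilon-1})\\ q^{m-2}&q-1\\ (q-1)(q^{m-3}+q^{\ell+\epsilon-2})&\frac{q-1}{2}(q^{m-2\epsilon-2}-q^{\ell-\epsilon-1})\\ (q-1)(q^{m-3}-q^{\ell+\epsilon-2})&\frac{q-1}{2}(q^{m-2\epsilon-2}+q^{\ell-\epsilon-1}) \end{array}$$ -/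

import Mathlib

namespace WeilCode

section LinearCodes

variable {F ι : Type*} [Field F] [DecidableEq F] [Fintype ι]

/-- `d` is the minimum Hamming distance of `C`: the least distance between two distinct
codewords. -/
def IsMinDistance (C : Submodule F (ι → F)) (d : ℚ) : Prop :=
  IsLeast {r : ℚ | ∃ x ∈ C, ∃ y ∈ C, x ≠ y ∧ (hammingDist x y : ℚ) = r} d

/-- `C` is a `t`-weight code: exactly `t` nonzero numbers occur as Hamming weights of
codewords. -/
def IsTWeight (C : Submodule F (ι → F)) (t : ℕ) : Prop :=
  {w : ℕ | w ≠ 0 ∧ ∃ c ∈ C, hammingNorm c = w}.ncard = t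

/-- The rows `(weight, frequency)` of `table` give the weight distribution of `C`: for every
number `w`, the number of codewords of weight `w` is the sum of the frequencies of the rows with
weight `w`. (So a number that is in no row is not a weight, and if two rows have the same weight
then their frequencies add up.) -/
def HasWeightDistribution (C : Submodule F (ι → F)) (table : List (ℚ × ℚ)) : Prop :=
  ∀ w : ℚ, ({c : ι → F | c ∈ C ∧ (hammingNorm c : ℚ) = w}.ncard : ℚ) =
    ((table.filter fun row => row.1 = w).map Prod.snd).sum

end LinearCodes

section TraceCodes

variable {F L : Type*} [Field F] [Field L] [Algebra F L]

/-- The code `C_D = {(Tr (b d))_{d ∈ D} : b ∈ L}` with defining set `D`, where `Tr` is the trace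
from `L` to `F`. The coordinates are indexed by the elements of `D`, so the length is `D.card`. -/
noncomputable def traceCode (F : Type*) {L : Type*} [Field F] [Field L] [Algebra F L]
    (D : Finset L) : Submodule F (D → F) :=
  LinearMap.range
    (LinearMap.pi fun d : D => (Algebra.trace F L).comp (LinearMap.mulRight F (d : L)))

/-- `D₁ = {x ∈ L^* : Tr (x^(q^e+1)) = u, Tr x = v}`, where `q = |F|`. -/
noncomputable def defSet₁ [Fintype F] [DecidableEq F] [Fintype L] [DecidableEq L]
    (e : ℕ) (u v : F) : Finset L :=
  Finset.univ.filter fun x : L =>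
    x ≠ 0 ∧ Algebra.trace F L (x ^ (Fintype.card F ^ e + 1)) = u ∧ Algebra.trace F L x = v

end TraceCodes

/-- For `m = 2ℓ`: `ε = 0` if `ℓ / gcd(m, e)` is odd, and `ε = gcd(m, e)` if it is even. -/
def epsilon (ℓ e : ℕ) : ℕ :=
  if Odd (ℓ / Nat.gcd (2 * ℓ) e) then 0 else Nat.gcd (2 * ℓ) e

end WeilCode

/-! Let B be the symmetric form with B(x,x) = Tr(x^(q^e+1)). Then B(1,y) = Tr y and B(1,1) = m_p, so
D₁ is the section B(x,x) = u, B(1,x) = v of a quadric. As the trace form is nondegenerate, the b in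
L correspond to the linear functionals φ on L, and the weight of a codeword is the number of points
of the section where φ ≠ 0.

The form takes all nonzero values equally often: each c in F_q^* is some z^(q^e+1), and x ↦ zx
multiplies B(x,x) by c. A second moment then determines the deviation κ from uniformity up to sign,
(qκ)² = |rad B|·|L| with |rad B| = q^(2ε). The sign follows from a divisibility: q^d+1, with d =
gcd(m,e), divides the number of solutions of B(x,x) = 1. This is `weilForm_radical_and_values`. By
double counting, `card_quadric_inter_affine` turns this distribution into the size of sections by
conditions B(w,x) = const, in terms of the points of a small quadric in the parameter space.

A functional not vanishing on rad B is equidistributed on the section, which gives one weight. If φ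
= B(w,·) is not a multiple of B(1,·), the weight is an affine function of the number of points of a
conic whose coefficients depend on β = B(1,w) and γ = B(w,w) only, and the number of w with given
(β,γ) is again a section count. Multiples of B(1,·) are constant on the section and have weight 0 or
full weight. So the weight enumerator becomes a sum over (β,γ) (`radical_mul_sum_sectionWeight`),
evaluated with quadratic character sums; the three parts are B(1,1) ≠ 0 with v² − uB(1,1) nonzero,
B(1,1) = 0, and v² − uB(1,1) = 0. With E = q^(2ε) and X = q^(ℓ−ε−2) everything is a polynomial
identity in q, E, X. -/

namespace WeilCode

open Finset

/-! ### Fibres of linear maps over finite fields. -/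

section FiberCounts

variable {F V U : Type*} [Field F] [AddCommGroup V] [Module F V] [Fintype V]
  [AddCommGroup U] [Module F U] [Fintype U]

open Classical in
/-- All fibres of a surjective linear map have the same size. -/
theorem card_fiber_mul (f : V →ₗ[F] U) (hf : Function.Surjective f) (u : U) :
    #{x | f x = u} * Fintype.card U = Fintype.card V := by
  have h : ∀ y ∈ (univ : Finset U), #{x | f x = y} = #{x | f x = u} := fun y _ =>
    AddMonoidHom.card_fiber_eq_of_mem_range f.toAddMonoidHom (hf y) (hf u)
  have := Finset.card_eq_sum_card_fiberwise (f := f) (s := univ) (t := univ) (by simp)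
  rw [Finset.sum_congr rfl h, Finset.sum_const, smul_eq_mul, mul_comm] at this
  exact this.symm

/-- The fibres of a nonzero linear functional. -/
theorem card_fiber_functional [Fintype F] [DecidableEq F] (f : U →ₗ[F] F) (hf : f ≠ 0) (a : F) :
    (#{c | f c = a} : ℚ) = Fintype.card U / Fintype.card F := by
  have hq : (Fintype.card F : ℚ) ≠ 0 := by exact_mod_cast Fintype.card_ne_zero
  rw [eq_div_iff hq]
  have := card_fiber_mul f (LinearMap.surjective hf) a
  norm_cast
  convert this

end FiberCounts

/-! ### Points of a quadric on affine subspaces, by double counting. -/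

section AffineCounts

variable {F V U : Type*} [Field F] [AddCommGroup V] [Module F V] [Fintype V]
  [AddCommGroup U] [Module F U] 

/-- Dual to the injectivity of c ↦ B (W c): the conditions imposed by W are independent, so every
right-hand side v is attained. -/
theorem surjective_flip_comp (B : LinearMap.BilinForm F V) (W : U →ₗ[F] V)
    (hW : ∀ c, B (W c) = 0 → c = 0) : Function.Surjective (B ∘ₗ W).flip := by
  rw [← LinearMap.flip_injective_iff₁, LinearMap.flip_flip]
  rw [injective_iff_map_eq_zero]
  exact hW

theorem card_dual [Fintype F] [Fintype U] [Fintype (Module.Dual F U)] :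
    Fintype.card (Module.Dual F U) = Fintype.card U := by
  rw [Module.card_eq_pow_finrank (K := F), Module.card_eq_pow_finrank (K := F) (V := U),
    Subspace.dual_finrank_eq]

open Classical in
/-- The number of solutions of `B x x = u` on the affine subspace `B (W c) x = v c`, in terms of
the number of points of a quadric in the parameter space `U`. The hypothesis `hN` says that
`x ↦ B x x` is equidistributed on the nonzero values. -/
theorem card_quadric_inter_affine [Fintype F] [Fintype U] [DecidableEq F]
    (h2 : (2 : F) ≠ 0) (B : LinearMap.BilinForm F V) (hB : ∀ x y, B x y = B y x) (κ : ℚ)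
    (hN : ∀ c : F, (#{x | B x x = c} : ℚ) = Fintype.card V / Fintype.card F + κ
      - (if c = 0 then Fintype.card F * κ else 0))
    (W : U →ₗ[F] V) (hW : ∀ c, B (W c) = 0 → c = 0) (v : Module.Dual F U) (u : F) :
    (Fintype.card U : ℚ) * #{x | B x x = u ∧ (B ∘ₗ W).flip x = v} =
      Fintype.card V / Fintype.card F + Fintype.card U * κ
        - Fintype.card F * κ * #{c | B (W c) (W c) + 2 * v c + u = 0} := by
  have : Fintype (Module.Dual F U) :=
    @Fintype.ofFinite _ (DFunLike.finite _)
  let φ := (B ∘ₗ W).flip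
  change (Fintype.card U : ℚ) * #{x | B x x = u ∧ φ x = v} = _
  have hφa : ∀ x c, φ x c = B (W c) x := fun x c => rfl
  have hfib : (#{x | φ x = v} : ℚ) * Fintype.card U = Fintype.card V := by
    have := card_fiber_mul φ (surjective_flip_comp B W hW) v
    rw [card_dual] at this
    convert (congrArg (Nat.cast (R := ℚ)) this) using 1
    push_cast
    congr!
  -- Pairs (x, c) are counted in two ways. For fixed x the terms quadratic in c cancel and an affine
  -- condition on c remains; it is equidistributed unless φ x = v, when all c or none satisfy it.
  have hx : ∀ x : V, (#{c | B (x + W c) (x + W c) = 2 * v c + u + B (W c) (W c)} : ℚ) =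
      Fintype.card U / Fintype.card F
        - (if φ x = v then (Fintype.card U / Fintype.card F : ℚ) else 0)
        + (if B x x = u ∧ φ x = v then (Fintype.card U : ℚ) else 0) := by
    intro x
    have e : ∀ c, (B (x + W c) (x + W c) = 2 * v c + u + B (W c) (W c)) ↔
        ((2 : F) • (φ x - v)) c = u - B x x := by
      intro c
      simp only [map_add, LinearMap.add_apply, LinearMap.smul_apply, LinearMap.sub_apply, hφa,
        smul_eq_mul, hB x (W c)]
      constructor <;> intro h <;> linear_combination h
    simp only [e]
    by_cases hv : φ x = v
    · simp only [hv, sub_self, smul_zero, LinearMap.zero_apply, if_true, and_true, zero_add]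
      by_cases hu : B x x = u
      · simp [hu]
      · rw [if_neg hu, Finset.filter_false_of_mem]
        · simp
        · intro c _ h
          exact hu (sub_eq_zero.1 h.symm).symm
    · rw [card_fiber_functional _ (smul_ne_zero h2 (sub_ne_zero.2 hv))]
      simp [hv]
  -- For fixed c, translation by W c reduces the count to `hN`.
  have hc : ∀ c : U, (#{x | B (x + W c) (x + W c) = 2 * v c + u + B (W c) (W c)} : ℚ) =
      Fintype.card V / Fintype.card F + κ
      - (if B (W c) (W c) + 2 * v c + u = 0 then Fintype.card F * κ else 0) := by
    intro c
    have h1 := hN (2 * v c + u + B (W c) (W c))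
    have e : (2 * v c + u + B (W c) (W c) = 0) ↔ (B (W c) (W c) + 2 * v c + u = 0) := by
      constructor <;> intro h <;> linear_combination h
    simp only [e] at h1
    rw [← h1]
    congr 1
    refine Finset.card_bij (fun x _ => x + W c) (by simp) (by simp) ?_
    intro y hy
    exact ⟨y - W c, by simpa only [mem_filter, mem_univ, true_and, sub_add_cancel] using hy, by simp⟩
  have hdouble : (∑ x : V, (#{c | B (x + W c) (x + W c) = 2 * v c + u + B (W c) (W c)} : ℚ)) =
      ∑ c : U, (#{x | B (x + W c) (x + W c) = 2 * v c + u + B (W c) (W c)} : ℚ) := by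
    simp only [Finset.card_filter, Nat.cast_sum]
    exact Finset.sum_comm
  simp only [hx, hc] at hdouble
  rw [Finset.sum_add_distrib, Finset.sum_sub_distrib, Finset.sum_sub_distrib] at hdouble
  simp only [← Finset.sum_filter, Finset.sum_const, nsmul_eq_mul, Finset.card_univ] at hdouble
  have h3 : (#{x | φ x = v} : ℚ) * (Fintype.card U / Fintype.card F) =
      Fintype.card V / Fintype.card F := by
    rw [← hfib]; ring
  rw [h3] at hdouble
  have h4 : (#{x | B x x = u ∧ φ x = v} : ℚ) * Fintype.card U =
      Fintype.card V / Fintype.card F + Fintype.card U * κ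
        - #{c | B (W c) (W c) + 2 * v c + u = 0} * (Fintype.card F * κ) := by
    linear_combination hdouble
  linear_combination h4

variable [Fintype F] [DecidableEq F]

/-- The number of solutions of `B x x = γ`, `B w₀ x = β`. -/
theorem card_quadric_inter_hyperplane (h2 : (2 : F) ≠ 0) (B : LinearMap.BilinForm F V)
    (hB : ∀ x y, B x y = B y x) (κ : ℚ)
    (hN : ∀ c : F, (#{x | B x x = c} : ℚ) = Fintype.card V / Fintype.card F + κ
      - (if c = 0 then Fintype.card F * κ else 0))
    (w₀ : V) (hw₀ : B w₀ ≠ 0) (β γ : F) :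
    (#{x | B x x = γ ∧ B w₀ x = β} : ℚ) =
      Fintype.card V / Fintype.card F ^ 2 + κ
        - κ * #{z | B w₀ w₀ * z ^ 2 + 2 * β * z + γ = 0} := by
  have hq : (Fintype.card F : ℚ) ≠ 0 := by exact_mod_cast Fintype.card_ne_zero
  have key := card_quadric_inter_affine h2 B hB κ hN (LinearMap.toSpanSingleton F V w₀)
    (by
      intro c hc
      rw [LinearMap.toSpanSingleton_apply, map_smul] at hc
      exact (smul_eq_zero.1 hc).resolve_right hw₀)
    (LinearMap.toSpanSingleton F F β) γ
  have e1 : ∀ x, ((B ∘ₗ LinearMap.toSpanSingleton F V w₀).flip x =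
      LinearMap.toSpanSingleton F F β) ↔ B w₀ x = β := by
    intro x
    rw [LinearMap.ext_ring_iff]
    simp
  have e2 : ∀ z, (B (LinearMap.toSpanSingleton F V w₀ z) (LinearMap.toSpanSingleton F V w₀ z)
      + 2 * LinearMap.toSpanSingleton F F β z + γ = 0) ↔
      B w₀ w₀ * z ^ 2 + 2 * β * z + γ = 0 := by
    intro z
    simp only [LinearMap.toSpanSingleton_apply, map_smul, LinearMap.smul_apply, smul_eq_mul]
    constructor <;> intro h <;> linear_combination h
  simp only [e1, e2] at key
  have hcount : (Fintype.card F : ℚ) * #{x | B x x = γ ∧ B w₀ x = β} =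
      Fintype.card V / Fintype.card F + Fintype.card F * κ
        - Fintype.card F * κ * #{z | B w₀ w₀ * z ^ 2 + 2 * β * z + γ = 0} := by
    convert key
  field_simp at hcount ⊢
  linear_combination hcount

/-- The number of solutions of `B x x = u`, `B w₀ x = v`, `B w x = 0`. -/
theorem card_quadric_inter_codim_two (h2 : (2 : F) ≠ 0) (B : LinearMap.BilinForm F V)
    (hB : ∀ x y, B x y = B y x) (κ : ℚ)
    (hN : ∀ c : F, (#{x | B x x = c} : ℚ) = Fintype.card V / Fintype.card F + κ
      - (if c = 0 then Fintype.card F * κ else 0))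
    (w₀ w : V) (hw₀ : B w₀ ≠ 0) (hw : ∀ c : F, B w ≠ c • B w₀) (u v : F) :
    (#{x | (B x x = u ∧ B w₀ x = v) ∧ B w x = 0} : ℚ) =
      Fintype.card V / Fintype.card F ^ 3 + κ
        - κ / Fintype.card F * #{z : F × F | B w₀ w₀ * z.1 ^ 2 + 2 * B w₀ w * z.1 * z.2
          + B w w * z.2 ^ 2 + 2 * v * z.1 + u = 0} := by
  have hq : (Fintype.card F : ℚ) ≠ 0 := by exact_mod_cast Fintype.card_ne_zero
  have key := card_quadric_inter_affine h2 B hB κ hN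
    ((LinearMap.toSpanSingleton F V w₀).coprod (LinearMap.toSpanSingleton F V w))
    (by
      rintro ⟨z, t⟩ hc
      simp only [LinearMap.coprod_apply, LinearMap.toSpanSingleton_apply, map_smul,
        map_add] at hc
      by_cases ht : t = 0
      · simp only [ht, zero_smul, add_zero] at hc
        rw [(smul_eq_zero.1 hc).resolve_right hw₀, ht]; rfl
      · refine absurd ?_ (hw (-(t⁻¹ * z)))
        have : t⁻¹ • (z • B w₀ + t • B w) = 0 := by rw [hc, smul_zero]
        rw [smul_add, smul_smul, smul_smul, inv_mul_cancel₀ ht, one_smul] at this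
        exact (eq_neg_of_add_eq_zero_right this).trans (neg_smul _ _).symm)
    ((LinearMap.toSpanSingleton F F v).coprod 0) u
  have e1 : ∀ x, ((B ∘ₗ ((LinearMap.toSpanSingleton F V w₀).coprod
      (LinearMap.toSpanSingleton F V w))).flip x =
      (LinearMap.toSpanSingleton F F v).coprod 0) ↔ B w₀ x = v ∧ B w x = 0 := by
    intro x
    rw [LinearMap.prod_ext_iff, LinearMap.ext_ring_iff, LinearMap.ext_ring_iff]
    simp
  have e2 : ∀ z : F × F, (B (((LinearMap.toSpanSingleton F V w₀).coprod
      (LinearMap.toSpanSingleton F V w)) z) (((LinearMap.toSpanSingleton F V w₀).coprod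
      (LinearMap.toSpanSingleton F V w)) z)
      + 2 * ((LinearMap.toSpanSingleton F F v).coprod (0 : F →ₗ[F] F)) z + u = 0) ↔
      B w₀ w₀ * z.1 ^ 2 + 2 * B w₀ w * z.1 * z.2
          + B w w * z.2 ^ 2 + 2 * v * z.1 + u = 0 := by
    intro z
    simp only [LinearMap.coprod_apply, LinearMap.toSpanSingleton_apply, map_smul, map_add,
      LinearMap.add_apply, LinearMap.smul_apply, smul_eq_mul, hB w w₀, LinearMap.zero_apply]
    constructor <;> intro h <;> linear_combination h
  simp only [e1, e2, ← and_assoc] at key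
  have hcount : ((Fintype.card F : ℚ) * Fintype.card F) *
        #{x | (B x x = u ∧ B w₀ x = v) ∧ B w x = 0} =
      Fintype.card V / Fintype.card F + (Fintype.card F * Fintype.card F) * κ
        - Fintype.card F * κ * #{z : F × F | B w₀ w₀ * z.1 ^ 2 + 2 * B w₀ w * z.1 * z.2
          + B w w * z.2 ^ 2 + 2 * v * z.1 + u = 0} := by
    rw [Fintype.card_prod] at key
    push_cast at key
    convert key
  generalize #{z : F × F | B w₀ w₀ * z.1 ^ 2 + 2 * B w₀ w * z.1 * z.2
          + B w w * z.2 ^ 2 + 2 * v * z.1 + u = 0} = M at hcount ⊢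
  field_simp at hcount ⊢
  linear_combination hcount

end AffineCounts

/-! ### Quadratic character sums and points of affine conics. -/

section QuadraticCharacterSums

variable {F : Type*} [Field F] [Fintype F] [DecidableEq F]

/-- The number of roots of `a z² + 2 β z + γ`. -/
def rootCount (a β γ : F) : ℕ := #{z | a * z ^ 2 + 2 * β * z + γ = 0}

/-- The number of points of the affine conic `a z² + 2 β z t + γ t² + 2 v z + u = 0`. -/
def conicCount (a β γ v u : F) : ℕ :=
  #{z : F × F | a * z.1 ^ 2 + 2 * β * z.1 * z.2 + γ * z.2 ^ 2 + 2 * v * z.1 + u = 0}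

theorem card_sqrts_rat (hF : ringChar F ≠ 2) (a : F) :
    (#{x : F | x ^ 2 = a} : ℚ) = quadraticChar F a + 1 := by
  have h := quadraticChar_card_sqrts hF a
  have e : {x : F | x ^ 2 = a}.toFinset = ({x : F | x ^ 2 = a} : Finset F) := by ext; simp
  rw [e] at h
  exact_mod_cast h

theorem rootCount_of_ne_zero (hF : ringChar F ≠ 2) {a : F} (ha : a ≠ 0) (β γ : F) :
    (rootCount a β γ : ℚ) = 1 + quadraticChar F (β ^ 2 - a * γ) := by
  rw [add_comm, ← card_sqrts_rat hF, rootCount]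
  congr 1
  refine card_bij (fun z _ => a * z + β) ?_ ?_ ?_
  · intro z hz
    simp only [mem_filter, mem_univ, true_and] at hz ⊢
    linear_combination a * hz
  · intro z _ z' _ h
    exact mul_left_cancel₀ ha (add_right_cancel h)
  · intro y hy
    simp only [mem_filter, mem_univ, true_and] at hy
    refine ⟨(y - β) / a, ?_, by field_simp; ring⟩
    simp only [mem_filter, mem_univ, true_and]
    field_simp
    linear_combination hy

theorem rootCount_zero_of_ne_zero (h2 : (2 : F) ≠ 0) {β : F} (hβ : β ≠ 0) (γ : F) :
    rootCount 0 β γ = 1 := by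
  rw [rootCount, card_eq_one]
  refine ⟨-γ / (2 * β), ?_⟩
  ext z
  simp only [mem_filter, mem_univ, true_and, mem_singleton]
  rw [eq_div_iff (mul_ne_zero h2 hβ)]
  constructor <;> intro h <;> linear_combination h

theorem rootCount_zero_zero (γ : F) :
    rootCount 0 0 γ = if γ = 0 then Fintype.card F else 0 := by
  by_cases h : γ = 0 <;> simp [rootCount, h]

/-- `conicCount` as a sum over the second coordinate. -/
theorem conicCount_eq_sum (a β γ v u : F) :
    conicCount a β γ v u = ∑ t, rootCount a (β * t + v) (γ * t ^ 2 + u) := by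
  simp only [conicCount, rootCount, card_filter]
  rw [Fintype.sum_prod_type, sum_comm]
  refine sum_congr rfl fun t _ => sum_congr rfl fun z _ => ?_
  congr 1
  apply propext
  constructor <;> intro h <;> linear_combination h

theorem card_mul_eq {d : F} (hd : d ≠ 0) :
    #{z : F × F | z.1 * z.2 = d} = Fintype.card F - 1 := by
  have : #{x : F | x ≠ 0} = Fintype.card F - 1 := by
    rw [filter_ne' univ (0 : F), card_erase_of_mem (mem_univ _), card_univ]
  rw [← this]
  refine card_bij (fun z _ => z.1) ?_ ?_ ?_
  · intro z hz
    simp only [mem_filter, mem_univ, true_and] at hz ⊢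
    rintro h
    rw [h, zero_mul] at hz
    exact hd hz.symm
  · intro z hz z' hz' h
    simp only [mem_filter, mem_univ, true_and] at hz hz'
    have hz0 : z.1 ≠ 0 := by
      rintro h
      rw [h, zero_mul] at hz
      exact hd hz.symm
    refine Prod.ext h (mul_left_cancel₀ hz0 ?_)
    rw [hz, h, hz']
  · intro x hx
    simp only [mem_filter, mem_univ, true_and] at hx
    exact ⟨(x, d / x), by simp only [mem_filter, mem_univ, true_and]; field_simp, rfl⟩

/-- The sum of χ(t² − d) + 1 counts the points of t² − x² = d, which becomes the hyperbola with q −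
1 points after factoring into (t − x)(t + x). -/
theorem sum_quadraticChar_sq_sub (hF : ringChar F ≠ 2) {d : F} (hd : d ≠ 0) :
    ∑ t : F, (quadraticChar F (t ^ 2 - d) : ℚ) = -1 := by
  have h2 : (2 : F) ≠ 0 := Ring.two_ne_zero hF
  have h1 : (∑ t : F, ((quadraticChar F (t ^ 2 - d) : ℚ) + 1)) = Fintype.card F - 1 := by
    simp only [← card_sqrts_rat hF]
    have hc : ((Fintype.card F - 1 : ℕ) : ℚ) = Fintype.card F - 1 := by
      rw [Nat.cast_sub Fintype.card_pos]; simp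
    rw [← hc, ← card_mul_eq hd, ← Nat.cast_sum]
    congr 1
    simp only [card_filter]
    rw [← Fintype.sum_prod_type']
    simp only [← card_filter]
    refine card_bij (fun z _ => (z.1 - z.2, z.1 + z.2)) ?_ ?_ ?_
    · intro z hz
      simp only [mem_filter, mem_univ, true_and] at hz ⊢
      linear_combination -hz
    · intro z _ z' _ h
      simp only [Prod.mk.injEq] at h
      obtain ⟨h1, h2'⟩ := h
      ext
      · exact mul_left_cancel₀ h2 (by linear_combination h1 + h2')
      · exact mul_left_cancel₀ h2 (by linear_combination h2' - h1)
    · intro y hy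
      simp only [mem_filter, mem_univ, true_and] at hy
      refine ⟨((y.1 + y.2) / 2, (y.2 - y.1) / 2), ?_, ?_⟩
      · simp only [mem_filter, mem_univ, true_and]
        field_simp
        linear_combination -4 * hy
      · ext <;> simp only <;> field_simp <;> ring
  rw [sum_add_distrib] at h1
  simp only [sum_const, card_univ, nsmul_eq_mul, mul_one] at h1
  linarith

theorem quadraticChar_sq_rat (a : F) :
    (quadraticChar F (a ^ 2) : ℚ) = if a = 0 then 0 else 1 := by
  by_cases ha : a = 0
  · simp [ha]
  · rw [quadraticChar_sq_one' ha, if_neg ha]; simp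

theorem sum_ite_eq_zero_else (c : ℚ) :
    ∑ t : F, (if t = 0 then 0 else c) = (Fintype.card F - 1) * c := by
  have : ∀ t : F, (if t = 0 then 0 else c) = c - (if t = 0 then c else 0) := by
    intro t; split_ifs <;> simp
  simp only [this, sum_sub_distrib, sum_ite_eq', mem_univ, if_true, sum_const, card_univ,
    nsmul_eq_mul]
  ring

/-- The sum of the quadratic character over the values of a quadratic polynomial. -/
theorem sum_quadraticChar_quadratic (hF : ringChar F ≠ 2) {δ : F} (hδ : δ ≠ 0) (b c : F) :
    ∑ t : F, (quadraticChar F (δ * t ^ 2 + 2 * b * t + c) : ℚ) =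
      -quadraticChar F δ + (if b ^ 2 = δ * c then Fintype.card F * quadraticChar F δ else 0) := by
  have hsq : (quadraticChar F δ : ℚ) * quadraticChar F δ = 1 := by
    have := quadraticChar_sq_one hδ
    rw [← sq]; exact_mod_cast this
  -- Completing the square: multiplication by δ turns the polynomial into (δt + b)² − (b² − δc).
  have h1 : ∀ t : F, (quadraticChar F (δ * t ^ 2 + 2 * b * t + c) : ℚ) =
      quadraticChar F δ * quadraticChar F ((δ * t + b) ^ 2 - (b ^ 2 - δ * c)) := by
    intro t
    have : (δ * t + b) ^ 2 - (b ^ 2 - δ * c) = δ * (δ * t ^ 2 + 2 * b * t + c) := by ring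
    rw [this, map_mul]
    push_cast
    rw [← mul_assoc, hsq, one_mul]
  simp only [h1, ← mul_sum]
  have h2 : ∑ t : F, (quadraticChar F ((δ * t + b) ^ 2 - (b ^ 2 - δ * c)) : ℚ) =
      ∑ t : F, (quadraticChar F (t ^ 2 - (b ^ 2 - δ * c)) : ℚ) :=
    Fintype.sum_equiv ((Equiv.mulLeft₀ δ hδ).trans (Equiv.addRight b)) _ _ (fun t => rfl)
  rw [h2]
  by_cases h : b ^ 2 = δ * c
  · rw [if_pos h, sub_eq_zero.2 h]
    simp only [sub_zero, quadraticChar_sq_rat, sum_ite_eq_zero_else]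
    push_cast
    ring
  · rw [if_neg h, sum_quadraticChar_sq_sub hF (sub_ne_zero.2 h)]
    ring

theorem sum_quadraticChar_eq_zero (hF : ringChar F ≠ 2) :
    ∑ t : F, (quadraticChar F t : ℚ) = 0 := by
  exact_mod_cast quadraticChar_sum_zero hF

theorem sum_quadraticChar_linear (hF : ringChar F ≠ 2) {b : F} (hb : b ≠ 0) (c : F) :
    ∑ t : F, (quadraticChar F (b * t + c) : ℚ) = 0 := by
  rw [← sum_quadraticChar_eq_zero hF]
  exact Fintype.sum_equiv ((Equiv.mulLeft₀ b hb).trans (Equiv.addRight c)) _ _ (fun t => rfl)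

/-- The nonzero squares and the nonsquares are equally many. -/
theorem sum_comp_quadraticChar (hF : ringChar F ≠ 2) (H : ℤ → ℚ) :
    ∑ δ : F, (if δ = 0 then 0 else H (quadraticChar F δ)) =
      (Fintype.card F - 1) / 2 * (H 1 + H (-1)) := by
  have h : ∀ δ : F, (if δ = 0 then 0 else H (quadraticChar F δ)) =
      (if δ = 0 then 0 else (H 1 + H (-1)) / 2)
        + (quadraticChar F δ : ℚ) * ((H 1 - H (-1)) / 2) := by
    intro δ
    by_cases hδ : δ = 0
    · simp [hδ]
    · rcases quadraticChar_dichotomy hδ with h | h <;> rw [if_neg hδ, if_neg hδ, h] <;>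
        push_cast <;> ring
  simp only [h, sum_add_distrib, ← sum_mul, sum_quadraticChar_eq_zero hF, sum_ite_eq_zero_else]
  ring

theorem conicCount_of_ne_zero (hF : ringChar F ≠ 2) {a : F} (ha : a ≠ 0) (β γ v u : F) :
    (conicCount a β γ v u : ℚ) = Fintype.card F +
      ∑ t : F, (quadraticChar F ((β ^ 2 - a * γ) * t ^ 2 + 2 * (β * v) * t + (v ^ 2 - a * u)) : ℚ)
      := by
  rw [conicCount_eq_sum, Nat.cast_sum]
  simp only [rootCount_of_ne_zero hF ha, sum_add_distrib, sum_const, card_univ, nsmul_eq_mul,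
    mul_one]
  congr 1
  refine sum_congr rfl fun t _ => ?_
  congr 3
  ring

/-- The condition in the `if` is the vanishing of the 3×3 determinant of the conic: then it is a
pair of lines meeting in one point, rational or conjugate according to the character. -/
theorem conicCount_of_disc_ne_zero (hF : ringChar F ≠ 2) {a : F} (ha : a ≠ 0) {β γ v u : F}
    (hδ : β ^ 2 - a * γ ≠ 0) :
    (conicCount a β γ v u : ℚ) = Fintype.card F - quadraticChar F (β ^ 2 - a * γ) +
      (if (β * v) ^ 2 = (β ^ 2 - a * γ) * (v ^ 2 - a * u) then
        Fintype.card F * quadraticChar F (β ^ 2 - a * γ) else 0 : ℚ) := by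
  rw [conicCount_of_ne_zero hF ha, sum_quadraticChar_quadratic hF hδ]
  push_cast
  ring

/-- For β ≠ 0 a parabola; for β = 0 also γ = 0, and the equation does not involve the second
coordinate. -/
theorem conicCount_of_disc_eq_zero (hF : ringChar F ≠ 2) {a : F} (ha : a ≠ 0) {β γ v u : F}
    (hv : v ≠ 0) (hδ : β ^ 2 - a * γ = 0) :
    (conicCount a β γ v u : ℚ) = Fintype.card F +
      (if β = 0 then Fintype.card F * quadraticChar F (v ^ 2 - a * u) else 0 : ℚ) := by
  have h2 : (2 : F) ≠ 0 := Ring.two_ne_zero hF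
  rw [conicCount_of_ne_zero hF ha, hδ]
  by_cases hβ : β = 0
  · simp [hβ]
  · simp only [zero_mul, zero_add, if_neg hβ]
    rw [sum_quadraticChar_linear hF (mul_ne_zero h2 (mul_ne_zero hβ hv))]

theorem conicCount_zero_zero (h2 : (2 : F) ≠ 0) {v : F} (hv : v ≠ 0) (γ u : F) :
    conicCount 0 0 γ v u = Fintype.card F := by
  rw [conicCount_eq_sum]
  simp [rootCount_zero_of_ne_zero h2 hv]

/-- For a = 0 the equation is linear in z with coefficient 2(βt + v). Only t = −v/β is exceptional:
there it holds for all z or for none. -/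
theorem conicCount_zero_of_ne_zero (h2 : (2 : F) ≠ 0) {β : F} (hβ : β ≠ 0) (γ v u : F) :
    (conicCount 0 β γ v u : ℚ) = Fintype.card F - 1 +
      (if γ * (v / β) ^ 2 + u = 0 then (Fintype.card F : ℚ) else 0) := by
  rw [conicCount_eq_sum, ← add_sum_erase _ _ (mem_univ (-(v / β)))]
  have h1 : ∀ t ∈ univ.erase (-(v / β)), rootCount 0 (β * t + v) (γ * t ^ 2 + u) = 1 := by
    intro t ht
    refine rootCount_zero_of_ne_zero h2 (fun h => (mem_erase.1 ht).1 ?_) _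
    field_simp
    linear_combination h
  have h3 : β * -(v / β) + v = 0 := by field_simp; ring
  rw [sum_congr rfl h1, h3, rootCount_zero_zero, sum_const, card_erase_of_mem (mem_univ _),
    card_univ, neg_sq]
  have h4 : ((Fintype.card F - 1 : ℕ) : ℚ) = Fintype.card F - 1 := by
    rw [Nat.cast_sub Fintype.card_pos]; simp
  rw [smul_eq_mul, mul_one, Nat.cast_add, h4, add_comm]
  push_cast
  rfl

end QuadraticCharacterSums

/-! ### Sums over all conics with fixed leading coefficient. -/

section ConicSums

variable {F : Type*} [Field F] [Fintype F]

theorem sum_disc {a : F} (ha : a ≠ 0) (β : F) (Φ : F → ℚ) :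
    ∑ γ : F, Φ (β ^ 2 - a * γ) = ∑ δ : F, Φ δ :=
  Fintype.sum_equiv ((Equiv.mulLeft₀ a ha).trans (Equiv.subLeft (β ^ 2))) _ _ (fun _ => rfl)

variable [DecidableEq F]

theorem sum_ite_zero (x y : ℚ) :
    ∑ t : F, (if t = 0 then x else y) = x + (Fintype.card F - 1) * y := by
  have : ∀ t : F, (if t = 0 then x else y) = (if t = 0 then x else 0) + if t = 0 then 0 else y := by
    intro t; split_ifs <;> simp
  simp only [this, sum_add_distrib, sum_ite_eq_zero_else, sum_ite_eq', mem_univ, if_true]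

/-- The sum over all `(β, γ)` of a function of the number of points of the conic, weighted by
the number of vectors with these parameters, for nonzero `v ^ 2 - a * u`. -/
theorem sum_conic_nondegenerate (hF : ringChar F ≠ 2) {a : F} (ha : a ≠ 0) {v u : F}
    (hv : v ≠ 0) (hΔ : v ^ 2 - a * u ≠ 0) (c κ : ℚ) (H : ℚ → ℚ) (q : ℚ)
    (hq : q = Fintype.card F) (η : ℚ) (hη : η = quadraticChar F (v ^ 2 - a * u)) :
    ∑ β : F, ∑ γ : F, (c + κ - κ * rootCount a β γ) * H (conicCount a β γ v u) =
      c * H (q + q * η) + (q - 1) * c * H q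
        + q * (q - 1) / 2 * ((c - κ) * H (q - 1) + (c + κ) * H (q + 1))
        + (q - 1) * (c - κ * η) * (H (q + (q - 1) * η) - H (q - η)) := by
  have key : ∀ β : F, ∑ γ : F, (c + κ - κ * rootCount a β γ) * H (conicCount a β γ v u) =
      (if β = 0 then c * H (q + q * η) else
        c * H q + (c - κ * η) * (H (q + (q - 1) * η) - H (q - η)))
        + (q - 1) / 2 * ((c - κ) * H (q - 1) + (c + κ) * H (q + 1)) := by
    intro β
    set E := (c - κ * η) * (H (q + (q - 1) * η) - H (q - η)) with hE
    -- For fixed β the summand depends on γ through δ = β² − aγ only. The three terms are δ = 0, the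
    -- generic value for δ ≠ 0, and the correction at the single δ where the conic degenerates.
    obtain ⟨Φ, hΦ⟩ : ∃ Φ : F → ℚ, ∀ δ, Φ δ =
          (if δ = 0 then c * H (if β = 0 then q + q * η else q) else 0)
          + (if δ = 0 then 0 else (fun x : ℤ => (c - κ * x) * H (q - x)) (quadraticChar F δ))
          + (if δ = (β * v) ^ 2 / (v ^ 2 - a * u) then (if β = 0 then 0 else E) else 0) :=
      ⟨_, fun _ => rfl⟩
    have h1 : ∀ γ : F, (c + κ - κ * rootCount a β γ) * H (conicCount a β γ v u) =
        Φ (β ^ 2 - a * γ) := by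
      intro γ
      rw [hΦ, rootCount_of_ne_zero hF ha]
      by_cases hδ : β ^ 2 - a * γ = 0
      · rw [conicCount_of_disc_eq_zero hF ha hv hδ, hδ, ← hη, ← hq]
        by_cases hβ : β = 0
        · simp [hβ]
        · have : (0 : F) ≠ (β * v) ^ 2 / (v ^ 2 - a * u) :=
            (div_ne_zero (pow_ne_zero _ (mul_ne_zero hβ hv)) hΔ).symm
          simp [hβ, this]
      · rw [conicCount_of_disc_ne_zero hF ha hδ, ← hq]
        by_cases hs : β ^ 2 - a * γ = (β * v) ^ 2 / (v ^ 2 - a * u)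
        · have hs' : (β * v) ^ 2 = (β ^ 2 - a * γ) * (v ^ 2 - a * u) := by
            rw [hs]; field_simp
          have hβ : β ≠ 0 := by
            rintro rfl
            exact mul_ne_zero hδ hΔ (by rw [← hs']; ring)
          -- The product of δ and v² − au is a nonzero square, so both have the same character.
          have hηδ : (quadraticChar F (β ^ 2 - a * γ) : ℚ) = η := by
            have h := congrArg (fun x => (quadraticChar F x : ℚ)) hs'
            simp only [map_mul, quadraticChar_sq_one' (mul_ne_zero hβ hv)] at h
            rw [hη]
            rcases quadraticChar_dichotomy hδ with h1 | h1 <;>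
            rcases quadraticChar_dichotomy hΔ with h2 | h2 <;>
            simp [h1, h2] at h ⊢ <;> norm_num at h
          simp only [if_pos hs', if_neg hδ, if_pos hs, if_neg hβ, hηδ, hE]
          ring_nf
        · have hs' : ¬ (β * v) ^ 2 = (β ^ 2 - a * γ) * (v ^ 2 - a * u) := by
            intro h; exact hs (by rw [h]; field_simp)
          simp only [if_neg hs', if_neg hδ, if_neg hs]
          ring_nf
    refine ((sum_congr rfl fun γ _ => h1 γ).trans (sum_disc ha β Φ)).trans ?_
    rw [sum_congr rfl fun δ _ => hΦ δ, sum_add_distrib, sum_add_distrib,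
      sum_comp_quadraticChar hF (fun x : ℤ => (c - κ * x) * H (q - x)), sum_ite_eq', sum_ite_eq',
      ← hq]
    by_cases hβ : β = 0
    · simp [hβ]
    · simp [hβ]; ring
  rw [sum_congr rfl fun β _ => key β, sum_add_distrib, sum_ite_zero, sum_const, card_univ,
    nsmul_eq_mul, ← hq]
  ring

/-- The same sum for `v ^ 2 = a * u`. -/
theorem sum_conic_tangent (hF : ringChar F ≠ 2) {a : F} (ha : a ≠ 0) {v u : F}
    (hv : v ≠ 0) (hΔ : v ^ 2 - a * u = 0) (c κ : ℚ) (H : ℚ → ℚ) (q : ℚ)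
    (hq : q = Fintype.card F) :
    ∑ β : F, ∑ γ : F, (c + κ - κ * rootCount a β γ) * H (conicCount a β γ v u) =
      q * c * H q
        + (q - 1) / 2 * ((c - κ) * H (2 * q - 1) + (c + κ) * H 1)
        + (q - 1) ^ 2 / 2 * ((c - κ) * H (q - 1) + (c + κ) * H (q + 1)) := by
  have key : ∀ β : F, ∑ γ : F, (c + κ - κ * rootCount a β γ) * H (conicCount a β γ v u) =
      (if β = 0 then (q - 1) / 2 * ((c - κ) * H (2 * q - 1) + (c + κ) * H 1) else
        (q - 1) / 2 * ((c - κ) * H (q - 1) + (c + κ) * H (q + 1))) + c * H q := by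
    intro β
    -- As v² = au, a conic with δ ≠ 0 degenerates exactly when β = 0.
    obtain ⟨Φ, hΦ⟩ : ∃ Φ : F → ℚ, ∀ δ, Φ δ = (if δ = 0 then c * H q else 0)
          + (if δ = 0 then 0 else
            (fun x : ℤ => (c - κ * x) * H (q - x + if β = 0 then q * x else 0))
              (quadraticChar F δ)) :=
      ⟨_, fun _ => rfl⟩
    have h1 : ∀ γ : F, (c + κ - κ * rootCount a β γ) * H (conicCount a β γ v u) =
        Φ (β ^ 2 - a * γ) := by
      intro γ
      rw [hΦ, rootCount_of_ne_zero hF ha]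
      by_cases hδ : β ^ 2 - a * γ = 0
      · rw [conicCount_of_disc_eq_zero hF ha hv hδ, hδ, hΔ, ← hq]
        simp
      · rw [conicCount_of_disc_ne_zero hF ha hδ, ← hq, hΔ]
        simp only [mul_zero, pow_eq_zero_iff two_ne_zero, mul_eq_zero, hv, or_false, if_neg hδ]
        ring_nf
    refine ((sum_congr rfl fun γ _ => h1 γ).trans (sum_disc ha β Φ)).trans ?_
    rw [sum_congr rfl fun δ _ => hΦ δ, sum_add_distrib,
      sum_comp_quadraticChar hF
        (fun x : ℤ => (c - κ * x) * H (q - x + if β = 0 then q * x else 0)), sum_ite_eq', ← hq]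
    by_cases hβ : β = 0
    · simp [hβ]; ring_nf
    · simp [hβ]; ring
  rw [sum_congr rfl fun β _ => key β, sum_add_distrib, sum_ite_zero, sum_const, card_univ,
    nsmul_eq_mul, ← hq]
  ring

/-- The same sum for `a = 0`. -/
theorem sum_conic_isotropic (hF : ringChar F ≠ 2) {v u : F}
    (hv : v ≠ 0) (c κ : ℚ) (H : ℚ → ℚ) (q : ℚ) (hq : q = Fintype.card F) :
    ∑ β : F, ∑ γ : F, (c + κ - κ * rootCount 0 β γ) * H (conicCount 0 β γ v u) =
      q * c * H q + (q - 1) * c * (H (2 * q - 1) + (q - 1) * H (q - 1)) := by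
  have h2 : (2 : F) ≠ 0 := Ring.two_ne_zero hF
  have key : ∀ β : F, ∑ γ : F, (c + κ - κ * rootCount 0 β γ) * H (conicCount 0 β γ v u) =
      if β = 0 then q * c * H q else c * (H (2 * q - 1) + (q - 1) * H (q - 1)) := by
    intro β
    by_cases hβ : β = 0
    · subst hβ
      have h1 : ∀ γ : F, (c + κ - κ * rootCount 0 0 γ) * H (conicCount 0 0 γ v u) =
          if γ = 0 then (c + κ - κ * q) * H q else (c + κ) * H q := by
        intro γ
        rw [conicCount_zero_zero h2 hv, rootCount_zero_zero, ← hq]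
        split_ifs <;> simp [hq]
      rw [sum_congr rfl fun γ _ => h1 γ, sum_ite_zero, ← hq, if_pos rfl]
      ring
    · have h1 : ∀ γ : F, (c + κ - κ * rootCount 0 β γ) * H (conicCount 0 β γ v u) =
          (fun t : F => if t = 0 then c * H (2 * q - 1) else c * H (q - 1))
            ((v / β) ^ 2 * γ + u) := by
        intro γ
        rw [conicCount_zero_of_ne_zero h2 hβ, rootCount_zero_of_ne_zero h2 hβ, ← hq,
          mul_comm γ]
        simp only
        split_ifs
        · push_cast; ring_nf
        · push_cast; ring_nf
      -- Since γ ↦ (v/β)²γ + u is a bijection, exactly one γ gives the degenerate count 2q − 1.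
      have hvβ : (v / β) ^ 2 ≠ 0 := pow_ne_zero _ (div_ne_zero hv hβ)
      refine ((sum_congr rfl fun γ _ => h1 γ).trans (Fintype.sum_equiv
        ((Equiv.mulLeft₀ _ hvβ).trans (Equiv.addRight u)) _
          (fun t : F => if t = 0 then c * H (2 * q - 1) else c * H (q - 1))
          (fun _ => rfl))).trans ?_
      rw [sum_ite_zero, ← hq, if_neg hβ]
      ring
  rw [sum_congr rfl fun β _ => key β, sum_ite_zero, ← hq]
  ring

/-- These are the conics attached to B w = t • B w₀, where the conic formula does not give the
weight; this sum is subtracted from the sum over all w. -/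
theorem sum_conic_line (hF : ringChar F ≠ 2) {a : F} (ha : a ≠ 0) {v u : F}
    (hv : v ≠ 0) (H : ℚ → ℚ) (q : ℚ) (hq : q = Fintype.card F) :
    ∑ t : F, H (conicCount a (t * a) (t ^ 2 * a) v u) =
      H (q + q * quadraticChar F (v ^ 2 - a * u)) + (q - 1) * H q := by
  have h : ∀ t : F, H (conicCount a (t * a) (t ^ 2 * a) v u) =
      if t = 0 then H (q + q * quadraticChar F (v ^ 2 - a * u)) else H q := by
    intro t
    rw [conicCount_of_disc_eq_zero hF ha hv (by ring), ← hq]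
    by_cases ht : t = 0 <;> simp [ht, ha]
  rw [sum_congr rfl fun t _ => h t, sum_ite_zero, ← hq]

theorem sum_conic_line_isotropic (hF : ringChar F ≠ 2) {v u : F}
    (hv : v ≠ 0) (H : ℚ → ℚ) (q : ℚ) (hq : q = Fintype.card F) :
    ∑ t : F, H (conicCount 0 (t * 0) (t ^ 2 * 0) v u) = q * H q := by
  have h2 : (2 : F) ≠ 0 := Ring.two_ne_zero hF
  simp [conicCount_zero_zero h2 hv, hq]

end ConicSums

/-! ### Weights of functionals on a quadric section. -/

section WeightEnumerator

variable {F V : Type*} [Field F] [DecidableEq F]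
  [AddCommGroup V] [Module F V] [Fintype V]

/-- The number of points with `φ x ≠ 0` on the section `B x x = u`, `B w₀ x = v` of a quadric. -/
def sectionWeight (B : LinearMap.BilinForm F V) (w₀ : V) (u v : F) (φ : Module.Dual F V) : ℕ :=
  #{x | (B x x = u ∧ B w₀ x = v) ∧ φ x ≠ 0}

theorem card_section_eq (B : LinearMap.BilinForm F V) (w₀ : V) (u v : F)
    (φ : Module.Dual F V) :
    (sectionWeight B w₀ u v φ : ℚ) =
      #{x | B x x = u ∧ B w₀ x = v} - #{x | (B x x = u ∧ B w₀ x = v) ∧ φ x = 0} := by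
  rw [eq_sub_iff_add_eq, sectionWeight, ← filter_filter (fun x => B x x = u ∧ B w₀ x = v),
    ← filter_filter (fun x => B x x = u ∧ B w₀ x = v)]
  norm_cast
  rw [add_comm]
  exact card_filter_add_card_filter_not (p := fun x => φ x = 0)

/-- A functional vanishing on the radical of a symmetric form is represented by the form. -/
theorem exists_eq_of_vanishes_on_radical {F V : Type*} [Field F] [AddCommGroup V] [Module F V]
    [Finite V] (B : LinearMap.BilinForm F V) (hB : ∀ x y, B x y = B y x) (φ : Module.Dual F V)
    (h : ∀ r, B r = 0 → φ r = 0) : ∃ w, B w = φ := by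
  have h1 : φ ∈ (LinearMap.ker B).dualAnnihilator := by
    rw [Submodule.mem_dualAnnihilator]
    exact fun r hr => h r hr
  rw [← LinearMap.range_dualMap_eq_dualAnnihilator_ker] at h1
  obtain ⟨ψ, hψ⟩ := h1
  obtain ⟨w, rfl⟩ := (Module.bijective_dual_eval F V).2 ψ
  refine ⟨w, ?_⟩
  rw [← hψ]
  ext x
  simp [hB w x]

/-- Such a φ is nonzero at some r in the radical. Translation by t • r preserves the section and
shifts φ by tφ(r), so φ takes each value equally often there. -/
theorem sectionWeight_of_not_range [Fintype F] (B : LinearMap.BilinForm F V)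
    (hB : ∀ x y, B x y = B y x) (w₀ : V) (u v : F) (φ : Module.Dual F V) (hφ : ∀ w, B w ≠ φ) :
    (sectionWeight B w₀ u v φ : ℚ) =
      (Fintype.card F - 1) / Fintype.card F * #{x | B x x = u ∧ B w₀ x = v} := by
  have hq : (Fintype.card F : ℚ) ≠ 0 := by exact_mod_cast Fintype.card_ne_zero
  obtain ⟨r, hr, hφr⟩ : ∃ r, B r = 0 ∧ φ r ≠ 0 := by
    by_contra! h
    obtain ⟨w, hw⟩ := exists_eq_of_vanishes_on_radical B hB φ h
    exact hφ w hw
  have hshift : ∀ (t : F) (x : V), (B (x + t • r) (x + t • r) = u ∧ B w₀ (x + t • r) = v) ↔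
      (B x x = u ∧ B w₀ x = v) := by
    intro t x
    simp only [map_add, map_smul, hr, hB _ r, smul_zero, add_zero, LinearMap.zero_apply]
  have h1 : ∀ t : F, #{x | (B x x = u ∧ B w₀ x = v) ∧ φ (x + t • r) = 0} =
      #{x | (B x x = u ∧ B w₀ x = v) ∧ φ x = 0} := by
    intro t
    refine card_bij (fun x _ => x + t • r) ?_ (by simp) ?_
    · intro x hx
      simp only [mem_filter, mem_univ, true_and, hshift] at hx ⊢
      exact hx
    · intro y hy
      simp only [mem_filter, mem_univ, true_and] at hy
      refine ⟨y - t • r, ?_, by simp⟩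
      simp only [mem_filter, mem_univ, true_and, sub_add_cancel]
      rw [← hshift t, sub_add_cancel]
      exact hy
  have h2 : ∀ x, #{t : F | (B x x = u ∧ B w₀ x = v) ∧ φ (x + t • r) = 0} =
      if B x x = u ∧ B w₀ x = v then 1 else 0 := by
    intro x
    by_cases hx : B x x = u ∧ B w₀ x = v
    · simp only [hx, and_self, true_and, if_true]
      rw [card_eq_one]
      refine ⟨-φ x / φ r, ?_⟩
      ext t
      simp only [mem_filter, mem_univ, true_and, mem_singleton, map_add, map_smul, smul_eq_mul]
      rw [eq_div_iff hφr]
      constructor <;> intro h <;> linear_combination h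
    · simp [hx]
  have h3 : ∑ t : F, #{x | (B x x = u ∧ B w₀ x = v) ∧ φ (x + t • r) = 0} =
      ∑ x : V, #{t : F | (B x x = u ∧ B w₀ x = v) ∧ φ (x + t • r) = 0} := by
    simp only [card_filter]
    exact sum_comm
  simp only [h1, h2, ← card_filter, sum_const, card_univ, smul_eq_mul] at h3
  have h4 : (Fintype.card F : ℚ) * #{x | (B x x = u ∧ B w₀ x = v) ∧ φ x = 0} =
      #{x | B x x = u ∧ B w₀ x = v} := by exact_mod_cast h3
  rw [card_section_eq, ← h4]
  field_simp

open Classical in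
theorem card_fiber_eq_radical {F V : Type*} [Field F] [DecidableEq F] [AddCommGroup V]
    [Module F V] [Fintype V] (B : LinearMap.BilinForm F V) (w : V) :
    #{x | B x = B w} = #{x | B x = 0} :=
  AddMonoidHom.card_fiber_eq_of_mem_range (LinearMap.toAddMonoidHom B) ⟨w, rfl⟩
    ⟨0, map_zero _⟩

-- The nonempty fibres of w ↦ B w are cosets of the radical.
open Classical in
theorem sum_comp_form [Fintype (Module.Dual F V)] (B : LinearMap.BilinForm F V)
    (h : Module.Dual F V → ℚ) :
    ∑ w, h (B w) = ∑ φ, if ∃ w, B w = φ then (#{x | B x = 0} : ℚ) * h φ else 0 := by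
  rw [← sum_fiberwise univ B]
  refine sum_congr rfl fun φ _ => ?_
  rw [sum_congr rfl (g := fun _ => h φ) (fun w hw => by rw [(mem_filter.1 hw).2]), sum_const,
    nsmul_eq_mul]
  split_ifs with hφ
  · obtain ⟨w, rfl⟩ := hφ
    rw [card_fiber_eq_radical]
  · rw [filter_false_of_mem]
    · simp
    · exact fun w _ hw => hφ ⟨w, hw⟩

open Classical in
/-- A sum over all functionals, split into those represented by the form and the others. -/
theorem radical_mul_sum_dual [Fintype F] [Fintype (Module.Dual F V)]
    (B : LinearMap.BilinForm F V)
    (h : Module.Dual F V → ℚ) (k : ℚ) (hk : ∀ φ, (∀ w, B w ≠ φ) → h φ = k) :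
    (#{x | B x = 0} : ℚ) * ∑ φ, h φ =
      ((#{x | B x = 0} : ℚ) - 1) * Fintype.card V * k + ∑ w, h (B w) := by
  -- The function h − k vanishes off the range of B.
  have h1 := sum_comp_form B (fun φ => h φ - k)
  have h2 : ∀ φ, (if ∃ w, B w = φ then (#{x | B x = 0} : ℚ) * (h φ - k) else 0) =
      (#{x | B x = 0} : ℚ) * (h φ - k) := by
    intro φ
    split_ifs with hφ
    · rfl
    · rw [hk φ (fun w hw => hφ ⟨w, hw⟩)]; ring
  simp only [h2, ← mul_sum, sum_sub_distrib, sum_const, card_univ, nsmul_eq_mul, card_dual] at h1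
  linear_combination -h1

open Classical in
/-- The weight enumerator of the section `B x x = u`, `B w₀ x = v`. -/
theorem radical_mul_sum_sectionWeight [Fintype F] [Fintype (Module.Dual F V)]
    (hF : ringChar F ≠ 2)
    (B : LinearMap.BilinForm F V) (hB : ∀ x y, B x y = B y x) (κ : ℚ)
    (hN : ∀ c : F, (#{x | B x x = c} : ℚ) = Fintype.card V / Fintype.card F + κ
      - (if c = 0 then Fintype.card F * κ else 0))
    (w₀ : V) (hw₀ : B w₀ ≠ 0) (u v : F) (hv : v ≠ 0) (f : ℚ → ℚ) (n c q : ℚ)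
    (hn : n = #{x | B x x = u ∧ B w₀ x = v}) (hq : q = Fintype.card F)
    (hc : c = Fintype.card V / q ^ 2) (H : ℚ → ℚ)
    (hH : ∀ M, H M = f (n - c / q - κ + κ / q * M)) :
    (#{x | B x = 0} : ℚ) * ∑ φ, f (sectionWeight B w₀ u v φ) =
      ((#{x | B x = 0} : ℚ) - 1) * Fintype.card V * f ((q - 1) / q * n)
      + #{x | B x = 0} * (f 0 + (q - 1) * f n
        - ∑ t : F, H (conicCount (B w₀ w₀) (t * B w₀ w₀) (t ^ 2 * B w₀ w₀) v u))
      + ∑ β : F, ∑ γ : F, (c + κ - κ * rootCount (B w₀ w₀) β γ)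
          * H (conicCount (B w₀ w₀) β γ v u) := by
  have h2 : (2 : F) ≠ 0 := Ring.two_ne_zero hF
  have hq0 : (q : ℚ) ≠ 0 := by rw [hq]; exact_mod_cast Fintype.card_ne_zero
  rw [radical_mul_sum_dual B (fun φ => f (sectionWeight B w₀ u v φ)) (f ((q - 1) / q * n))
    (fun φ hφ => by rw [sectionWeight_of_not_range B hB w₀ u v φ hφ, hq, hn]), add_assoc]
  congr 1
  -- The conic formula is used for every w and corrected where B w = t • B w₀: there the functional
  -- is the constant tv on the section, so the weight is 0 for t = 0 and n otherwise.
  have hpt : ∀ w, f (sectionWeight B w₀ u v (B w)) =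
      (∑ t : F, if B w = t • B w₀ then ((if t = 0 then f 0 else f n)
        - H (conicCount (B w₀ w₀) (t * B w₀ w₀) (t ^ 2 * B w₀ w₀) v u)) else 0)
      + H (conicCount (B w₀ w₀) (B w₀ w) (B w w) v u) := by
    intro w
    by_cases hw : ∃ t : F, B w = t • B w₀
    · obtain ⟨t, ht⟩ := hw
      rw [sum_eq_single t]
      · have hβ : B w₀ w = t * B w₀ w₀ := by rw [hB, ht]; rfl
        have hγ : B w w = t ^ 2 * B w₀ w₀ := by
          rw [ht, LinearMap.smul_apply, hβ, smul_eq_mul]; ring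
        rw [if_pos ht, hβ, hγ, sub_add_cancel, ht, sectionWeight]
        by_cases ht0 : t = 0
        · simp [ht0]
        · rw [if_neg ht0, hn]
          congr 3
          ext x
          simp only [mem_filter, mem_univ, true_and, LinearMap.smul_apply, smul_eq_mul,
            and_iff_left_iff_imp]
          rintro ⟨-, hx⟩
          rw [hx]
          exact mul_ne_zero ht0 hv
      · intro t' _ ht'
        rw [if_neg]
        rw [ht]
        intro h
        exact ht' (smul_left_injective F hw₀ h).symm
      · simp
    · push Not at hw
      rw [sum_eq_zero (fun t _ => if_neg (hw t)), zero_add, hH, card_section_eq,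
        card_quadric_inter_codim_two h2 B hB κ hN w₀ w hw₀ hw u v, ← hn, ← hq, hc, ← conicCount]
      congr 1
      field_simp
      ring
  rw [sum_congr rfl fun w _ => hpt w, sum_add_distrib, sum_comm]
  congr 1
  · have h3 : ∀ t : F, (∑ w, if B w = t • B w₀ then ((if t = 0 then f 0 else f n)
        - H (conicCount (B w₀ w₀) (t * B w₀ w₀) (t ^ 2 * B w₀ w₀) v u)) else 0) =
        #{x | B x = 0} * ((if t = 0 then f 0 else f n)
          - H (conicCount (B w₀ w₀) (t * B w₀ w₀) (t ^ 2 * B w₀ w₀) v u)) := by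
      intro t
      rw [← sum_filter, sum_const, nsmul_eq_mul, ← map_smul, card_fiber_eq_radical]
    rw [sum_congr rfl fun t _ => h3 t, ← mul_sum, sum_sub_distrib, sum_ite_zero, ← hq]
  -- The w are grouped by (β, γ) = (B w₀ w, B w w); each class is itself a hyperplane section of a
  -- quadric.
  · rw [← Fintype.sum_prod_type', ← sum_fiberwise univ (fun w => (B w₀ w, B w w))]
    refine sum_congr rfl fun p _ => ?_
    rw [sum_congr rfl (g := fun _ => H (conicCount (B w₀ w₀) p.1 p.2 v u))
      (fun w hw => by rw [← (mem_filter.1 hw).2]), sum_const, nsmul_eq_mul]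
    congr 1
    rw [hc, hq, rootCount, ← card_quadric_inter_hyperplane h2 B hB κ hN w₀ hw₀ p.1 p.2]
    congr 2
    ext w
    simp only [mem_filter, mem_univ, true_and, Prod.ext_iff]
    exact and_comm

end WeightEnumerator

/-! ### Roots of unity and power equations in finite fields. -/

section RootsInFiniteFields

variable {L : Type*} [Field L] [Fintype L]

theorem card_pow_eq_one [DecidableEq L] {n : ℕ} (hn : 0 < n) :
    #{x : L | x ^ n = 1} = Nat.gcd (Fintype.card L - 1) n := by
  have h := IsCyclic.card_powMonoidHom_ker (G := Lˣ) n
  rw [Nat.card_eq_fintype_card, Nat.card_eq_fintype_card, Fintype.card_units] at h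
  rw [← h, ← Fintype.card_coe]
  refine (Fintype.card_of_bijective (f := fun y : (powMonoidHom n : Lˣ →* Lˣ).ker =>
    (⟨((y : Lˣ) : L), ?_⟩ : ({x : L | x ^ n = 1} : Finset L))) ⟨?_, ?_⟩).symm
  · have := y.2
    rw [MonoidHom.mem_ker, powMonoidHom_apply, Units.ext_iff] at this
    simpa using this
  · intro y y' h
    exact Subtype.ext (Units.ext (congrArg Subtype.val h))
  · rintro ⟨x, hx⟩
    simp only [mem_filter, mem_univ, true_and] at hx
    refine ⟨⟨Units.ofPowEqOne x n hx hn.ne', ?_⟩, ?_⟩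
    · rw [MonoidHom.mem_ker, powMonoidHom_apply]
      ext
      simp
    · simp

/-- If c = g^i for a generator g of order tPs, then c^t = 1 forces Ps to divide i. -/
theorem exists_pow_eq {c : L} (hc : c ≠ 0) {t P s : ℕ} (ht : 0 < t) (hct : c ^ t = 1)
    (hN : Fintype.card L - 1 = t * (P * s)) : ∃ z : L, z ^ P = c := by
  classical
  obtain ⟨g, hg⟩ := IsCyclic.exists_monoid_generator (α := Lˣ)
  have hord : orderOf g = t * (P * s) := by
    rw [orderOf_eq_card_of_forall_mem_powers hg, Nat.card_eq_fintype_card, Fintype.card_units, hN]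
  obtain ⟨i, hi⟩ := hg (Units.mk0 c hc)
  have hi' : g ^ i = Units.mk0 c hc := hi
  have h1 : g ^ (i * t) = 1 := by
    rw [pow_mul, hi']
    ext
    simpa using hct
  have h2 := orderOf_dvd_of_pow_eq_one h1
  rw [hord, mul_comm i] at h2
  obtain ⟨j, rfl⟩ := Nat.dvd_of_mul_dvd_mul_left ht h2
  refine ⟨((g ^ (s * j) : Lˣ) : L), ?_⟩
  rw [← Units.val_pow_eq_pow_val, ← pow_mul, show s * j * P = P * s * j by ring, hi']
  rfl

/-- Two n-th powers bring z back to itself, so an odd number of them acts like one. -/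
theorem pow_pow_odd {M : Type*} [Monoid M] {z : M} {n : ℕ} (h : z ^ n ^ 2 = z) (i : ℕ) :
    z ^ n ^ (2 * i + 1) = z ^ n := by
  induction i with
  | zero => simp
  | succ i ih =>
    rw [show 2 * (i + 1) + 1 = (2 * i + 1) + 2 by ring, pow_add, pow_mul, ih, ← pow_mul, mul_comm,
      pow_mul, h]

end RootsInFiniteFields

/-! ### Value distribution of a quadratic form from its second moment. -/

section ValueCounts

variable {F V : Type*} [Field F] [Fintype F] [DecidableEq F]
  [AddCommGroup V] [Module F V] [Fintype V]

open Classical in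
/-- The second moment of the numbers of representations by a quadratic form. -/
theorem sum_sq_card_values (h2 : (2 : F) ≠ 0) (B : LinearMap.BilinForm F V)
    (hB : ∀ x y, B x y = B y x) :
    ∑ c : F, (#{x | B x x = c} : ℚ) ^ 2 =
      #{x | B x = 0} * Fintype.card V
        + (Fintype.card V - #{x | B x = 0}) * (Fintype.card V / Fintype.card F) := by
  -- The second moment counts pairs (x, h) with B (x + h) (x + h) = B x x; for fixed h this is an
  -- affine condition on x, degenerate exactly for h in the radical.
  have h1 : ∀ h : V, (#{x | B (x + h) (x + h) = B x x} : ℚ) =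
      if B h = 0 then (Fintype.card V : ℚ) else Fintype.card V / Fintype.card F := by
    intro h
    have e : ∀ x, (B (x + h) (x + h) = B x x) ↔ ((2 : F) • B h) x = -B h h := by
      intro x
      simp only [map_add, LinearMap.add_apply, LinearMap.smul_apply, smul_eq_mul, hB x h]
      constructor <;> intro h <;> linear_combination h
    simp only [e]
    split_ifs with hh
    · simp [hh]
    · exact card_fiber_functional _ (smul_ne_zero h2 hh) _
  have h3 : ∀ x : V, (#{h | B (x + h) (x + h) = B x x} : ℚ) = #{y | B y y = B x x} := by
    intro x
    congr 1
    refine card_bij (fun h _ => x + h) (by simp) (by simp) ?_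
    intro y hy
    refine ⟨y - x, ?_, by simp⟩
    simpa only [mem_filter, mem_univ, true_and, add_sub_cancel] using hy
  have h4 : ∑ x : V, (#{h | B (x + h) (x + h) = B x x} : ℚ) =
      ∑ h : V, (#{x | B (x + h) (x + h) = B x x} : ℚ) := by
    simp only [card_filter, Nat.cast_sum]
    exact sum_comm
  rw [sum_congr rfl fun x _ => h3 x, sum_congr rfl fun x _ => h1 x] at h4
  have h5 : ∑ x : V, (#{y | B y y = B x x} : ℚ) = ∑ c : F, (#{x | B x x = c} : ℚ) ^ 2 := by
    rw [← sum_fiberwise univ (fun x => B x x)]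
    refine sum_congr rfl fun c _ => ?_
    rw [sum_congr rfl (g := fun _ => (#{y | B y y = c} : ℚ))
      (fun w hw => by rw [(mem_filter.1 hw).2]), sum_const, nsmul_eq_mul, sq]
  rw [← h5, h4, sum_ite, sum_const, sum_const, nsmul_eq_mul, nsmul_eq_mul]
  congr 2
  rw [eq_sub_iff_add_eq, add_comm, ← Nat.cast_add, card_filter_add_card_filter_not, card_univ]

open Classical in
/-- If all nonzero values are taken equally often, then the deviation from the uniform
distribution is determined up to sign. -/
theorem card_values_of_const (h2 : (2 : F) ≠ 0) (B : LinearMap.BilinForm F V)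
    (hB : ∀ x y, B x y = B y x)
    (hconst : ∀ c : F, c ≠ 0 → #{x | B x x = c} = #{x | B x x = 1}) (κ : ℚ)
    (hκ : κ = #{x | B x x = 1} - (Fintype.card V : ℚ) / Fintype.card F) :
    (∀ c : F, (#{x | B x x = c} : ℚ) = Fintype.card V / Fintype.card F + κ
      - (if c = 0 then Fintype.card F * κ else 0)) ∧
    (Fintype.card F * κ) ^ 2 = #{x | B x = 0} * Fintype.card V := by
  have hq : (Fintype.card F : ℚ) ≠ 0 := by exact_mod_cast Fintype.card_ne_zero
  have hq1 : (Fintype.card F : ℚ) - 1 ≠ 0 := by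
    rw [sub_ne_zero]
    exact_mod_cast Fintype.one_lt_card.ne'
  have hval : ∀ c : F, (#{x | B x x = c} : ℚ) =
      if c = 0 then (#{x | B x x = 0} : ℚ) else #{x | B x x = 1} := by
    intro c
    split_ifs with hc
    · rw [hc]
    · rw [hconst c hc]
  have hsum : ∑ c : F, (#{x | B x x = c} : ℚ) = Fintype.card V := by
    rw [← Nat.cast_sum]
    exact_mod_cast (card_eq_sum_card_fiberwise (f := fun x => B x x) (s := univ) (t := univ)
      (by simp)).symm
  have hsq := sum_sq_card_values h2 B hB
  have hsq' : ∀ c : F, (#{x | B x x = c} : ℚ) ^ 2 =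
      if c = 0 then (#{x | B x x = 0} : ℚ) ^ 2 else (#{x | B x x = 1} : ℚ) ^ 2 := by
    intro c
    rw [hval c]; split_ifs <;> rfl
  rw [sum_congr rfl fun c _ => hval c, sum_ite_zero] at hsum
  rw [sum_congr rfl fun c _ => hsq' c, sum_ite_zero] at hsq
  have h1 : (#{x | B x x = 1} : ℚ) = Fintype.card V / Fintype.card F + κ := by rw [hκ]; ring
  have h0 : (#{x | B x x = 0} : ℚ) = Fintype.card V / Fintype.card F + κ - Fintype.card F * κ := by
    have : (#{x | B x x = 0} : ℚ) = Fintype.card V - (Fintype.card F - 1) * #{x | B x x = 1} := by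
      linarith
    rw [this, h1]
    field_simp
    ring
  refine ⟨fun c => ?_, ?_⟩
  · rw [hval c]
    split_ifs with hc
    · exact h0
    · rw [h1, sub_zero]
  · rw [h0, h1] at hsq
    refine mul_left_cancel₀ (mul_ne_zero hq hq1) ?_
    field_simp at hsq
    linear_combination hsq

end ValueCounts

/-! ### The bilinear form behind Tr(x^(q^e+1)). -/

section TraceForm

variable {F L : Type*} [Field F] [Fintype F] [Field L] [Finite L] [Algebra F L]

/-- The bilinear form `(Tr (x^(q^e) y) + Tr (x y^(q^e))) / 2`. -/
noncomputable def weilForm (F L : Type*) [Field F] [Fintype F] [Field L] [Finite L]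
    [Algebra F L] (e : ℕ) : LinearMap.BilinForm F L :=
  LinearMap.mk₂ F (fun x y => 2⁻¹ * (Algebra.trace F L
      ((FiniteField.frobeniusAlgEquivOfAlgebraic F L ^ e) x * y)
      + Algebra.trace F L (x * (FiniteField.frobeniusAlgEquivOfAlgebraic F L ^ e) y)))
    (fun x x' y => by simp only [map_add, add_mul]; ring)
    (fun c x y => by simp only [map_smul, smul_mul_assoc, smul_eq_mul]; ring)
    (fun x y y' => by simp only [map_add, mul_add]; ring)
    (fun c x y => by simp only [map_smul, mul_smul_comm, smul_eq_mul]; ring)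

theorem frobenius_pow_apply (e : ℕ) (x : L) :
    (FiniteField.frobeniusAlgEquivOfAlgebraic F L ^ e) x = x ^ Fintype.card F ^ e := by
  rw [AlgEquiv.coe_pow, FiniteField.coe_frobeniusAlgEquivOfAlgebraic_iterate]

theorem trace_pow_card_pow (e : ℕ) (x : L) :
    Algebra.trace F L (x ^ Fintype.card F ^ e) = Algebra.trace F L x := by
  rw [← frobenius_pow_apply (F := F), Algebra.trace_eq_of_algEquiv]

theorem weilForm_apply (e : ℕ) (x y : L) :
    weilForm F L e x y = 2⁻¹ * (Algebra.trace F L (x ^ Fintype.card F ^ e * y)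
      + Algebra.trace F L (x * y ^ Fintype.card F ^ e)) := by
  rw [← frobenius_pow_apply (F := F), ← frobenius_pow_apply (F := F)]
  rfl

theorem weilForm_comm (e : ℕ) (x y : L) : weilForm F L e x y = weilForm F L e y x := by
  rw [weilForm_apply, weilForm_apply, add_comm, mul_comm x, mul_comm y]

theorem weilForm_self (h2 : (2 : F) ≠ 0) (e : ℕ) (x : L) :
    weilForm F L e x x = Algebra.trace F L (x ^ (Fintype.card F ^ e + 1)) := by
  rw [weilForm_apply, pow_succ, mul_comm x, ← two_mul, inv_mul_cancel_left₀ h2]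

theorem weilForm_one (h2 : (2 : F) ≠ 0) (e : ℕ) (y : L) :
    weilForm F L e 1 y = Algebra.trace F L y := by
  rw [weilForm_apply, one_pow, one_mul, one_mul, trace_pow_card_pow, ← two_mul,
    inv_mul_cancel_left₀ h2]

theorem weilForm_one_one (h2 : (2 : F) ≠ 0) (e : ℕ) :
    weilForm F L e 1 1 = (Module.finrank F L : F) := by
  rw [weilForm_one h2, ← map_one (algebraMap F L), Algebra.trace_algebraMap]
  simp

theorem weilForm_one_ne_zero (h2 : (2 : F) ≠ 0) (e : ℕ) : weilForm F L e 1 ≠ 0 := by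
  intro h
  refine Algebra.trace_ne_zero F L (LinearMap.ext fun y => ?_)
  rw [← weilForm_one h2 e y, h]

/-- Applying the e-th Frobenius power inside the first trace gives B(x,y) = Tr((x^(q^(2e)) + x)
y^(q^e))/2; the trace form is nondegenerate. -/
theorem weilForm_eq_zero_iff (h2 : (2 : F) ≠ 0) (e : ℕ) (x : L) :
    weilForm F L e x = 0 ↔ x ^ Fintype.card F ^ (2 * e) = -x := by
  have key : ∀ y, weilForm F L e x y = 2⁻¹ * Algebra.trace F L
      ((x ^ Fintype.card F ^ (2 * e) + x) * (FiniteField.frobeniusAlgEquivOfAlgebraic F L ^ e) y)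
      := by
    intro y
    rw [weilForm_apply, ← trace_pow_card_pow e (x ^ _ * y), mul_pow, ← pow_mul, ← pow_add,
      ← two_mul, add_mul, map_add, frobenius_pow_apply]
  constructor
  · intro h
    rw [← add_eq_zero_iff_eq_neg]
    refine (traceForm_nondegenerate F L).1 _ fun z => ?_
    have := key ((FiniteField.frobeniusAlgEquivOfAlgebraic F L ^ e).symm z)
    rw [h, AlgEquiv.apply_symm_apply, LinearMap.zero_apply, eq_comm, mul_eq_zero] at this
    exact this.resolve_left (inv_ne_zero h2)
  · intro h
    ext y
    rw [key, h]
    simp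

theorem weilForm_mul_self (h2 : (2 : F) ≠ 0) (e : ℕ) (z x : L) (c : F)
    (hz : z ^ (Fintype.card F ^ e + 1) = algebraMap F L c) :
    weilForm F L e (z * x) (z * x) = c * weilForm F L e x x := by
  rw [weilForm_self h2, weilForm_self h2, mul_pow, hz, ← Algebra.smul_def, map_smul, smul_eq_mul]

end TraceForm

/-! ### Arithmetic of m, e and gcd(m, e). -/

section Arithmetic

theorem odd_card {F : Type*} [Field F] [Fintype F] (hF : ringChar F ≠ 2) : Odd (Fintype.card F) :=
  Nat.odd_iff.2 (FiniteField.odd_card_of_char_ne_two hF)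

/-- `d = gcd(m, e)`, `m = 2 d k`, `e = d j` with `j` odd and coprime to `k`. -/
theorem exists_gcd_decomposition {m ℓ e : ℕ} (hℓ : m = 2 * ℓ) (he : 0 < e)
    (heven : Even (m / Nat.gcd m e)) : ∃ d k i, 0 < d ∧ Nat.gcd m e = d ∧ ℓ = d * k ∧
      e = d * (2 * i + 1) ∧ Nat.gcd k (2 * i + 1) = 1 := by
  have hd : 0 < Nat.gcd m e := Nat.gcd_pos_of_pos_right _ he
  obtain ⟨k, hk⟩ := heven
  have hm : m = Nat.gcd m e * (2 * k) := by
    rw [two_mul, ← hk, Nat.mul_div_cancel' (Nat.gcd_dvd_left m e)]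
  have hj : e = Nat.gcd m e * (e / Nat.gcd m e) := by
    rw [Nat.mul_div_cancel' (Nat.gcd_dvd_right m e)]
  have hcop : Nat.Coprime (2 * k) (e / Nat.gcd m e) := by
    have := Nat.coprime_div_gcd_div_gcd hd
    rwa [hk, ← two_mul] at this
  have hodd : Odd (e / Nat.gcd m e) := by
    rw [← Nat.not_even_iff_odd]
    intro h
    have : 2 ∣ Nat.gcd (2 * k) (e / Nat.gcd m e) :=
      Nat.dvd_gcd (dvd_mul_right _ _) h.two_dvd
    rw [hcop] at this
    omega
  obtain ⟨i, hi⟩ := hodd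
  refine ⟨Nat.gcd m e, k, i, hd, rfl, ?_, by rw [← hi]; exact hj, ?_⟩
  · have : 2 * ℓ = 2 * (Nat.gcd m e * k) := by
      rw [← hℓ]; nlinarith
    omega
  · rw [← hi]
    exact Nat.Coprime.coprime_dvd_left (dvd_mul_left _ _) hcop

theorem epsilon_eq {ℓ e d k : ℕ} (hd : 0 < d) (hg : Nat.gcd (2 * ℓ) e = d) (hℓ : ℓ = d * k) :
    epsilon ℓ e = if Odd k then 0 else d := by
  rw [epsilon, hg, hℓ, Nat.mul_div_cancel_left _ hd]

theorem sub_one_mul_geom_sum {n : ℕ} (hn : 0 < n) (k : ℕ) :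
    n ^ k - 1 = (n - 1) * ∑ i ∈ range k, n ^ i := by
  rw [mul_comm, geom_sum_mul_of_one_le hn]

theorem odd_geom_sum_iff {n : ℕ} (hn : Odd n) (k : ℕ) :
    Odd (∑ i ∈ range k, n ^ i) ↔ Odd k := by
  rw [odd_sum_iff_odd_card_odd, filter_true_of_mem fun i _ => hn.pow, card_range]

end Arithmetic

/-! ### Radical, equidistribution and divisibility for the trace form. -/

section RadicalAndValues

variable {F L : Type*} [Field F] [Fintype F] [Field L] [Fintype L] [Algebra F L]

/-- Put A = q^(2d), so |L| = A^k. For odd k, raising x^(A^(2i+1)−1) = −1 to the odd power 1 + A + ⋯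
+ A^(k−1) gives −1 = 1. For even k there is z with z^(A−1) = −1, and dividing by z maps the
solutions onto the fixed points of y ↦ y^(A^(2i+1)), which form the field with A elements as k and
2i+1 are coprime. -/
theorem card_radical [DecidableEq L] (hF : ringChar F ≠ 2) {d k i : ℕ} (hd : 0 < d)
    (hcop : Nat.gcd k (2 * i + 1) = 1) (hL : Fintype.card L = Fintype.card F ^ (2 * (d * k))) :
    #{x : L | x ^ Fintype.card F ^ (2 * (d * (2 * i + 1))) = -x} =
      Fintype.card F ^ (2 * if Odd k then 0 else d) := by
  set q := Fintype.card F with hq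
  have hq2 : 1 < q := Fintype.one_lt_card
  set A := q ^ (2 * d) with hA
  have hA1 : 1 < A := Nat.one_lt_pow (by omega) hq2
  have hAodd : Odd A := (odd_card hF).pow
  have hN : Fintype.card L - 1 = (A - 1) * ∑ j ∈ range k, A ^ j := by
    rw [hL, ← sub_one_mul_geom_sum (by omega), hA, ← pow_mul, mul_assoc]
  have hQ : q ^ (2 * (d * (2 * i + 1))) = A ^ (2 * i + 1) := by
    rw [hA, ← pow_mul, mul_assoc]
  have hQ1 : 1 < A ^ (2 * i + 1) := Nat.one_lt_pow (by omega) hA1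
  have hL2 : (2 : L) ≠ 0 := by
    rw [← map_ofNat (algebraMap F L) 2]
    exact (map_ne_zero _).2 (Ring.two_ne_zero hF)
  have hneg : (-1 : L) ≠ 1 := by
    intro h
    exact hL2 (by linear_combination -h)
  rw [hQ]
  split_ifs with hkodd
  · rw [mul_zero, pow_zero, card_eq_one]
    refine ⟨0, ?_⟩
    ext x
    simp only [mem_filter, mem_univ, true_and, mem_singleton]
    constructor
    · intro hx
      by_contra hx0
      have h1 : x ^ (A ^ (2 * i + 1) - 1) = -1 := by
        refine mul_right_cancel₀ hx0 ?_
        rw [← pow_succ, Nat.sub_add_cancel hQ1.le, hx, neg_one_mul]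
      have h2 : (x ^ (A ^ (2 * i + 1) - 1)) ^ (∑ j ∈ range k, A ^ j) = 1 := by
        rw [sub_one_mul_geom_sum (by omega : 0 < A) (2 * i + 1), ← pow_mul, mul_right_comm, ← hN,
          pow_mul, FiniteField.pow_card_sub_one_eq_one x hx0, one_pow]
      rw [h1, ((odd_geom_sum_iff hAodd k).2 hkodd).neg_one_pow] at h2
      exact hneg h2
    · rintro rfl
      rw [zero_pow (by omega), neg_zero]
  · have hK : Even (∑ j ∈ range k, A ^ j) := by
      rw [← Nat.not_odd_iff_even, odd_geom_sum_iff hAodd]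
      exact hkodd
    obtain ⟨K', hK'⟩ := hK
    obtain ⟨z, hz⟩ := exists_pow_eq (L := L) (c := -1) (t := 2) (P := A - 1) (s := K')
      (by simp) two_pos (by simp) (by rw [hN, hK']; ring)
    have hz0 : z ≠ 0 := by
      rintro rfl
      rw [zero_pow (by omega)] at hz
      simp at hz
    have hzA : z ^ A = -z := by
      rw [← Nat.sub_add_cancel hA1.le, pow_succ, hz, neg_one_mul]
    have hzQ : z ^ A ^ (2 * i + 1) = -z := by
      rw [pow_pow_odd _ i, hzA]
      rw [sq, pow_mul, hzA, hAodd.neg_pow, hzA, neg_neg]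
    have e1 : #{x : L | x ^ A ^ (2 * i + 1) = -x} = #{y : L | y ^ A ^ (2 * i + 1) = y} := by
      symm
      refine card_bij (fun y _ => z * y) ?_ ?_ ?_
      · intro y hy
        simp only [mem_filter, mem_univ, true_and] at hy ⊢
        rw [mul_pow, hzQ, hy, neg_mul]
      · intro y _ y' _ h
        exact mul_left_cancel₀ hz0 h
      · intro x hx
        simp only [mem_filter, mem_univ, true_and] at hx
        refine ⟨x / z, ?_, by field_simp⟩
        simp only [mem_filter, mem_univ, true_and]
        rw [div_pow, hx, hzQ, neg_div_neg_eq]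
    have e2 : ({y : L | y ^ A ^ (2 * i + 1) = y} : Finset L) =
        insert 0 ({y : L | y ^ (A ^ (2 * i + 1) - 1) = 1} : Finset L) := by
      ext y
      simp only [mem_filter, mem_univ, true_and, mem_insert]
      by_cases hy : y = 0
      · simp [hy, (zero_lt_one.trans hA1).ne']
      · simp only [hy, false_or]
        conv_lhs => rw [← Nat.sub_add_cancel hQ1.le, pow_succ]
        exact mul_eq_right₀ hy
    rw [e1, e2, card_insert_of_notMem, card_pow_eq_one (by omega), hL, ← hQ,
      Nat.pow_sub_one_gcd_pow_sub_one, Nat.gcd_mul_left, Nat.gcd_mul_left, hcop, mul_one,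
      Nat.sub_add_cancel hA1.le]
    simp only [mem_filter, mem_univ, true_and]
    rw [zero_pow (by omega)]
    exact zero_ne_one

/-- Some z with z^(q^(2d)) = z satisfies z^(q^d+1) = c. As e/d is odd, also z^(q^e+1) = c, and x ↦
zx carries the value 1 to c. -/
theorem card_values_const [DecidableEq F] (hF : ringChar F ≠ 2) {d k i : ℕ} (hd : 0 < d)
    (hL : Fintype.card L = Fintype.card F ^ (2 * (d * k))) (c : F) (hc : c ≠ 0) :
    #{x : L | weilForm F L (d * (2 * i + 1)) x x = c} =
      #{x : L | weilForm F L (d * (2 * i + 1)) x x = 1} := by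
  have h2 : (2 : F) ≠ 0 := Ring.two_ne_zero hF
  have hq2 : 1 < Fintype.card F := Fintype.one_lt_card
  have hn1 : 1 < Fintype.card F ^ d := Nat.one_lt_pow hd.ne' hq2
  have hcq : algebraMap F L c ^ (Fintype.card F - 1) = 1 := by
    rw [← map_pow, FiniteField.pow_card_sub_one_eq_one c hc, map_one]
  have hc0 : algebraMap F L c ≠ 0 := (map_ne_zero _).2 hc
  have hfac : (Fintype.card F ^ d) ^ 2 - 1 = (Fintype.card F ^ d + 1) * (Fintype.card F ^ d - 1) := by
    rw [← Nat.sq_sub_sq, one_pow]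
  obtain ⟨z, hz⟩ := exists_pow_eq (L := L) hc0 (t := Fintype.card F - 1)
    (P := Fintype.card F ^ d + 1)
    (s := (∑ j ∈ range d, Fintype.card F ^ j) * ∑ j ∈ range k, ((Fintype.card F ^ d) ^ 2) ^ j)
    (by omega) hcq (by
      rw [hL, show Fintype.card F ^ (2 * (d * k)) = ((Fintype.card F ^ d) ^ 2) ^ k by
        rw [← pow_mul, ← pow_mul]; ring_nf, sub_one_mul_geom_sum (by positivity), hfac,
        sub_one_mul_geom_sum (by omega : 0 < Fintype.card F) d]
      ring)
  have hz0 : z ≠ 0 := by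
    rintro rfl
    rw [zero_pow (by omega)] at hz
    exact hc0 hz.symm
  have hzn : z ^ (Fintype.card F ^ d) ^ 2 = z := by
    have : z ^ ((Fintype.card F ^ d) ^ 2 - 1) = 1 := by
      rw [hfac, pow_mul, hz, sub_one_mul_geom_sum (by omega : 0 < Fintype.card F) d, pow_mul, hcq,
        one_pow]
    rw [← Nat.sub_add_cancel (Nat.one_le_pow 2 _ (by omega : 0 < Fintype.card F ^ d)), pow_succ,
      this, one_mul]
  have hze : z ^ (Fintype.card F ^ (d * (2 * i + 1)) + 1) = algebraMap F L c := by
    rw [pow_succ, pow_mul (Fintype.card F), pow_pow_odd hzn, ← pow_succ, hz]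
  symm
  refine card_bij (fun x _ => z * x) ?_ ?_ ?_
  · intro x hx
    simp only [mem_filter, mem_univ, true_and] at hx ⊢
    rw [weilForm_mul_self h2 _ _ _ c hze, hx, mul_one]
  · intro x _ y _ h
    exact mul_left_cancel₀ hz0 h
  · intro y hy
    simp only [mem_filter, mem_univ, true_and] at hy
    refine ⟨y / z, ?_, by field_simp⟩
    simp only [mem_filter, mem_univ, true_and]
    have := weilForm_mul_self h2 _ z (y / z) c hze
    rw [mul_div_cancel₀ _ hz0, hy] at this
    exact mul_left_cancel₀ hc (by rw [← this, mul_one])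

/-- The `(q^d+1)`-st roots of unity act freely on the solutions of `B x x = 1`. -/
theorem dvd_card_values [DecidableEq F] [DecidableEq L] (hF : ringChar F ≠ 2) {d k i : ℕ}
    (hL : Fintype.card L = Fintype.card F ^ (2 * (d * k))) :
    Fintype.card F ^ d + 1 ∣ #{x : L | weilForm F L (d * (2 * i + 1)) x x = 1} := by
  have h2 : (2 : F) ≠ 0 := Ring.two_ne_zero hF
  set P := Fintype.card F ^ d + 1 with hP
  set S : Finset L := {x : L | weilForm F L (d * (2 * i + 1)) x x = 1} with hS
  have hroots : #{ζ : L | ζ ^ P = 1} = P := by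
    rw [card_pow_eq_one (by omega)]
    refine Nat.gcd_eq_right ?_
    rw [hL, show Fintype.card F ^ (2 * (d * k)) = ((Fintype.card F ^ d) ^ 2) ^ k by
        rw [← pow_mul, ← pow_mul]; ring_nf,
      sub_one_mul_geom_sum (pow_pos (pow_pos Fintype.card_pos _) _)]
    refine Dvd.dvd.mul_right ?_ _
    rw [show (Fintype.card F ^ d) ^ 2 - 1 = (Fintype.card F ^ d + 1) * (Fintype.card F ^ d - 1) by
      rw [← Nat.sq_sub_sq, one_pow]]
    exact dvd_mul_right _ _
  -- Because e/d is odd, roots of unity of order dividing q^d + 1 preserve B x x.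
  have hPe : P ∣ Fintype.card F ^ (d * (2 * i + 1)) + 1 := by
    have := Odd.nat_add_dvd_pow_add_pow (Fintype.card F ^ d) 1 (n := 2 * i + 1) ⟨i, rfl⟩
    rwa [one_pow, ← pow_mul] at this
  -- The fibres of x ↦ x^P on S are the orbits of the P-th roots of unity, each of size P.
  rw [card_eq_sum_card_image (fun x => x ^ P) S]
  refine dvd_sum fun b hb => ?_
  obtain ⟨x₀, hx₀, rfl⟩ := mem_image.1 hb
  have hx₀' : weilForm F L (d * (2 * i + 1)) x₀ x₀ = 1 := by simpa [hS] using hx₀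
  have hne : x₀ ≠ 0 := by
    rintro rfl
    simp at hx₀'
  refine dvd_of_eq ?_
  refine hroots.symm.trans ?_
  refine card_bij (fun ζ _ => ζ * x₀) ?_ ?_ ?_
  · intro ζ hζ
    simp only [mem_filter, mem_univ, true_and, hS] at hζ ⊢
    refine ⟨?_, by rw [mul_pow, hζ, one_mul]⟩
    rw [weilForm_mul_self h2 _ _ _ 1, hx₀', one_mul]
    obtain ⟨t, ht⟩ := hPe
    rw [ht, pow_mul, hζ, one_pow, map_one]
  · intro ζ _ ζ' _ h
    exact mul_right_cancel₀ hne h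
  · intro y hy
    refine ⟨y / x₀, ?_, by field_simp⟩
    simp only [mem_filter, mem_univ, true_and] at hy ⊢
    rw [div_pow, hy.2, div_self (pow_ne_zero _ hne)]

end RadicalAndValues

/-! ### The sign of the deviation, and the bound on ε. -/

section ValueDistribution

variable {F L : Type*} [Field F] [Fintype F] [DecidableEq F] [Field L] [Fintype L]
  [DecidableEq L] [Algebra F L]

open Classical in
/-- The radical and the value distribution of the form `Tr (x^(q^e+1))`: it is of minus type. -/
theorem weilForm_radical_and_values (hF : ringChar F ≠ 2) {ℓ e ε : ℕ}
    (hm : Module.finrank F L = 2 * ℓ) (hℓ : 0 < ℓ) (he : 0 < e)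
    (heven : Even (2 * ℓ / Nat.gcd (2 * ℓ) e)) (hε : ε = epsilon ℓ e) :
    #{x | weilForm F L e x = 0} = Fintype.card F ^ (2 * ε) ∧
    ∀ c : F, (#{x | weilForm F L e x x = c} : ℚ) =
      (Fintype.card L : ℚ) / Fintype.card F + (Fintype.card F : ℚ) ^ (ℓ + ε - 1)
        - (if c = 0 then Fintype.card F * (Fintype.card F : ℚ) ^ (ℓ + ε - 1) else 0) := by
  have h2 : (2 : F) ≠ 0 := Ring.two_ne_zero hF
  obtain ⟨d, k, i, hd, hg, rfl, rfl, hcop⟩ := exists_gcd_decomposition rfl he heven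
  rw [epsilon_eq hd hg rfl] at hε
  have hL : Fintype.card L = Fintype.card F ^ (2 * (d * k)) := by
    rw [Module.card_eq_pow_finrank (K := F), hm]
  have hq2 : 1 < Fintype.card F := Fintype.one_lt_card
  have hq0 : (Fintype.card F : ℚ) ≠ 0 := by exact_mod_cast Fintype.card_ne_zero
  have hrad : #{x | weilForm F L (d * (2 * i + 1)) x = 0} = Fintype.card F ^ (2 * ε) := by
    rw [hε, ← card_radical (L := L) hF hd hcop hL]
    congr 1
    ext x
    simp only [mem_filter, mem_univ, true_and, weilForm_eq_zero_iff h2]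
  refine ⟨hrad, ?_⟩
  obtain ⟨hval, hsq⟩ := card_values_of_const h2 (weilForm F L (d * (2 * i + 1)))
    (weilForm_comm _) (fun c hc => card_values_const hF hd hL c hc) _ rfl
  set κ : ℚ := #{x | weilForm F L (d * (2 * i + 1)) x x = 1} -
    (Fintype.card L : ℚ) / Fintype.card F with hκ
  suffices h : κ = (Fintype.card F : ℚ) ^ (d * k + ε - 1) by
    rw [h] at hval
    exact hval
  have hsq' : (Fintype.card F * κ) ^ 2 = ((Fintype.card F : ℚ) ^ (d * k + ε)) ^ 2 := by
    rw [hsq, ← pow_mul]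
    have : (#{x | weilForm F L (d * (2 * i + 1)) x = 0} : ℚ) = (Fintype.card F : ℚ) ^ (2 * ε) := by
      exact_mod_cast hrad
    rw [hL, Nat.cast_pow]
    rw [this, ← pow_add]
    congr 1
    ring
  have hpow : (Fintype.card F : ℚ) ^ (d * k + ε) =
      Fintype.card F * (Fintype.card F : ℚ) ^ (d * k + ε - 1) := by
    rw [← pow_succ', Nat.sub_add_cancel (by omega)]
  rcases sq_eq_sq_iff_eq_or_eq_neg.1 hsq' with h | h
  · rw [hpow] at h
    exact mul_left_cancel₀ hq0 h
  -- With the minus sign, q·#{B x x = 1} = q^m − q^(ℓ+ε). Modulo q^d + 1 the left side is 0 and the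
  -- right side is 1 − (−1) = 2, but q^d + 1 > 2.
  · exfalso
    obtain ⟨N, hN⟩ := dvd_card_values (L := L) (d := d) (k := k) (i := i) hF hL
    have h3 : (Fintype.card F : ℚ) * ((Fintype.card F ^ d + 1) * N) =
        (Fintype.card F : ℚ) ^ (2 * (d * k)) - (Fintype.card F : ℚ) ^ (d * k + ε) := by
      have h4 : (#{x | weilForm F L (d * (2 * i + 1)) x x = 1} : ℚ) =
          (Fintype.card F ^ d + 1) * N := by
        rw [hN]; push_cast; rfl
      rw [← h4, ← Nat.cast_pow, ← hL, sub_eq_add_neg, ← h, hκ]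
      field_simp
      ring
    have h5 : (Fintype.card F : ℤ) * ((Fintype.card F ^ d + 1) * N) =
        (Fintype.card F : ℤ) ^ (2 * (d * k)) - (Fintype.card F : ℤ) ^ (d * k + ε) := by
      exact_mod_cast h3
    have h6 : ((Fintype.card F : ℤ) ^ d + 1) ∣ 2 := by
      have h7 : ((Fintype.card F : ℤ) ^ d + 1) ∣ (Fintype.card F : ℤ) ^ (2 * (d * k)) - 1 := by
        have : (Fintype.card F : ℤ) ^ (2 * (d * k)) = (((Fintype.card F : ℤ) ^ d) ^ 2) ^ k := by
          rw [← pow_mul, ← pow_mul]; ring_nf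
        rw [this]
        refine Dvd.dvd.trans ?_ (sub_one_dvd_pow_sub_one _ k)
        exact ⟨(Fintype.card F : ℤ) ^ d - 1, by ring⟩
      -- In both cases of the definition of ε, (ℓ + ε)/d is odd: it is k or k + 1.
      obtain ⟨r, hr, hrodd⟩ : ∃ r, d * k + ε = d * r ∧ Odd r := by
        rw [hε]
        split_ifs with hk
        · exact ⟨k, by ring, hk⟩
        · exact ⟨k + 1, by ring, (Nat.not_odd_iff_even.1 hk).add_one⟩
      have h8 : ((Fintype.card F : ℤ) ^ d + 1) ∣ (Fintype.card F : ℤ) ^ (d * k + ε) + 1 := by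
        rw [hr, pow_mul]
        simpa using hrodd.add_dvd_pow_add_pow ((Fintype.card F : ℤ) ^ d) 1
      have h9 : (2 : ℤ) = Fintype.card F * ((Fintype.card F ^ d + 1) * N)
          - ((Fintype.card F : ℤ) ^ (2 * (d * k)) - 1)
          + ((Fintype.card F : ℤ) ^ (d * k + ε) + 1) := by rw [h5]; ring
      rw [h9]
      exact dvd_add (dvd_sub (Dvd.dvd.mul_left (dvd_mul_right _ _) _) h7) h8
    have h10 := Int.le_of_dvd two_pos h6
    have h11 : 1 < (Fintype.card F : ℤ) ^ d := by
      exact_mod_cast Nat.one_lt_pow hd.ne' hq2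
    omega

/-- The codimension of the radical is at least `4` unless `m = 4` and `ε = 1`. -/
theorem epsilon_add_two_le {ℓ e : ℕ} (hℓ : 2 ≤ ℓ) (he : 0 < e)
    (heven : Even (2 * ℓ / Nat.gcd (2 * ℓ) e)) (hne : ℓ ≠ 2 ∨ epsilon ℓ e ≠ 1) :
    epsilon ℓ e + 2 ≤ ℓ := by
  obtain ⟨d, k, i, hd, hg, hdk, rfl, hcop⟩ := exists_gcd_decomposition rfl he heven
  have h := epsilon_eq hd hg hdk
  rw [h] at hne ⊢
  split_ifs with hk
  · omega
  · rw [if_neg hk] at hne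
    obtain ⟨j, hj⟩ := Nat.not_odd_iff_even.1 hk
    have hj0 : 0 < j := by
      rcases Nat.eq_zero_or_pos j with h0 | h0
      · rw [hj, h0] at hdk; omega
      · exact h0
    have : 2 * d ≤ ℓ := by rw [hdk, hj]; nlinarith
    omega

end ValueDistribution

/-! ### Code parameters from a weight enumerator. -/

section CodeParameters

/-- Positive frequencies cannot cancel, so the weights listed are exactly those that occur, even if
rows coincide. -/
theorem sum_filter_pos_iff {table : List (ℚ × ℚ)} (hpos : ∀ r ∈ table, 0 < r.2) (w : ℚ) :
    0 < ((table.filter fun row => row.1 = w).map Prod.snd).sum ↔ w ∈ table.map Prod.fst := by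
  induction table with
  | nil => simp
  | cons r t ih =>
    have ih' := ih fun r' hr' => hpos r' (List.mem_cons_of_mem _ hr')
    have hr : 0 < r.2 := hpos r List.mem_cons_self
    have hnn : 0 ≤ ((t.filter fun row => row.1 = w).map Prod.snd).sum := by
      refine List.sum_nonneg fun x hx => ?_
      obtain ⟨p, hp, rfl⟩ := List.mem_map.1 hx
      exact (hpos p (List.mem_cons_of_mem _ (List.mem_filter.1 hp).1)).le
    by_cases h : r.1 = w
    · simp only [List.filter_cons, h, decide_true, if_true, List.map_cons, List.sum_cons,
        List.mem_cons, true_or, iff_true]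
      linarith
    · simp only [List.filter_cons, h, decide_false, Bool.false_eq_true, if_false, List.map_cons,
        List.mem_cons, ih', Ne.symm h, false_or]

theorem sum_map_indicator (table : List (ℚ × ℚ)) (w : ℚ) :
    (table.map fun r => r.2 * if r.1 = w then 1 else 0).sum =
      ((table.filter fun row => row.1 = w).map Prod.snd).sum := by
  induction table with
  | nil => simp
  | cons r t ih =>
    rw [List.map_cons, List.sum_cons, ih]
    by_cases h : r.1 = w <;> simp [h]

variable {F ι : Type*} [Field F] [DecidableEq F] [Fintype ι]

theorem exists_weight_iff [Finite F] {C : Submodule F (ι → F)} {table : List (ℚ × ℚ)}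
    (hC : HasWeightDistribution C table) (hpos : ∀ r ∈ table, 0 < r.2) (w : ℚ) :
    (∃ c ∈ C, (hammingNorm c : ℚ) = w) ↔ w ∈ table.map Prod.fst := by
  rw [← sum_filter_pos_iff hpos, ← hC w, Nat.cast_pos, Set.ncard_pos (Set.toFinite _)]
  rfl

theorem isMinDistance_of_hasWeightDistribution [Finite F] {C : Submodule F (ι → F)}
    {rows : List (ℚ × ℚ)} (hC : HasWeightDistribution C ((0, 1) :: rows))
    (hpos : ∀ r ∈ rows, 0 < r.2) {d : ℚ} (hd : 0 < d) (hmem : d ∈ rows.map Prod.fst)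
    (hle : ∀ r ∈ rows, d ≤ r.1) : IsMinDistance C d := by
  have hiff := exists_weight_iff hC (by simpa using hpos)
  constructor
  · obtain ⟨c, hc, hcd⟩ := (hiff d).2 (List.mem_cons_of_mem _ hmem)
    refine ⟨c, hc, 0, C.zero_mem, ?_, by rw [hammingDist_zero_right, hcd]⟩
    rintro rfl
    rw [hammingNorm_zero, Nat.cast_zero] at hcd
    exact hd.ne hcd
  · rintro r ⟨x, hx, y, hy, hxy, rfl⟩
    rw [hammingDist_comm, hammingDist_eq_hammingNorm]
    have h := (hiff _).1 ⟨-y + x, by simpa [add_comm, ← sub_eq_add_neg] using C.sub_mem hx hy, rfl⟩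
    rcases List.mem_cons.1 h with h | h
    · exfalso
      have : hammingNorm (-y + x) = 0 := Nat.cast_eq_zero.1 h
      rw [hammingNorm_eq_zero, neg_add_eq_zero] at this
      exact hxy this.symm
    · obtain ⟨p, hp, hpe⟩ := List.mem_map.1 h
      rw [← hpe]
      exact hle p hp

theorem isTWeight_of_hasWeightDistribution [Finite F] {C : Submodule F (ι → F)}
    {rows : List (ℚ × ℚ)} (hC : HasWeightDistribution C ((0, 1) :: rows))
    (hpos : ∀ r ∈ rows, 0 < r.2) (hw : ∀ r ∈ rows, 0 < r.1) :
    IsTWeight C (rows.map Prod.fst).toFinset.card := by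
  have hiff := exists_weight_iff hC (by simpa using hpos)
  rw [IsTWeight, ← Set.ncard_image_of_injective _ (Nat.cast_injective (R := ℚ)),
    ← Set.ncard_coe_finset]
  congr 1
  ext w
  simp only [Set.mem_image, Set.mem_ofPred_eq, SetLike.mem_coe, List.mem_toFinset]
  constructor
  · rintro ⟨n, ⟨hn, c, hc, rfl⟩, rfl⟩
    rcases List.mem_cons.1 ((hiff _).1 ⟨c, hc, rfl⟩) with h | h
    · exact absurd (Nat.cast_eq_zero.1 h) hn
    · exact h
  · intro h
    obtain ⟨c, hc, hcw⟩ := (hiff w).2 (List.mem_cons_of_mem _ h)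
    refine ⟨_, ⟨?_, c, hc, rfl⟩, hcw⟩
    intro h0
    rw [h0, Nat.cast_zero] at hcw
    obtain ⟨p, hp, hpe⟩ := List.mem_map.1 h
    exact (hw p hp).ne (hcw.trans hpe.symm)

variable {E : Type*} [AddCommGroup E] [Module F E] [Fintype E]

/-- An encoder whose weight enumerator has one word of weight zero is injective. -/
theorem hasWeightDistribution_range (T : E →ₗ[F] ι → F) {rows : List (ℚ × ℚ)}
    (hT : ∀ f : ℚ → ℚ, ∑ b, f (hammingNorm (T b)) =
      (((0, 1) :: rows).map fun r => r.2 * f r.1).sum) (hw : ∀ r ∈ rows, 0 < r.1) :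
    Function.Injective T ∧ HasWeightDistribution (LinearMap.range T) ((0, 1) :: rows) := by
  have hcount : ∀ w : ℚ, (#{b | (hammingNorm (T b) : ℚ) = w} : ℚ) =
      ((((0, 1) :: rows).filter fun row => row.1 = w).map Prod.snd).sum := by
    intro w
    -- Testing the enumerator on the indicator function of w.
    rw [← sum_map_indicator, ← hT fun x => if x = w then 1 else 0]
    simp
  have hinj : Function.Injective T := by
    rw [injective_iff_map_eq_zero]
    intro b hb
    have h0 := hcount 0
    have hrows : rows.filter (fun row => row.1 = 0) = [] := by
      rw [List.filter_eq_nil_iff]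
      intro r hr
      simpa using (hw r hr).ne'
    rw [List.filter_cons_of_pos (by simp), hrows] at h0
    simp only [List.map_cons, List.map_nil, List.sum_cons, List.sum_nil, add_zero] at h0
    have h1 : #{b | (hammingNorm (T b) : ℚ) = 0} = 1 := by exact_mod_cast h0
    exact card_le_one.1 h1.le b (by simp [hb]) 0 (by simp)
  refine ⟨hinj, fun w => ?_⟩
  rw [← hcount w]
  congr 1
  have : {c : ι → F | c ∈ LinearMap.range T ∧ (hammingNorm c : ℚ) = w} =
      T '' (({b | (hammingNorm (T b) : ℚ) = w} : Finset E) : Set E) := by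
    ext c
    simp only [LinearMap.mem_range, Set.mem_ofPred_eq, coe_filter, mem_univ, true_and,
      Set.mem_image]
    constructor
    · rintro ⟨⟨b, rfl⟩, h⟩
      exact ⟨b, h, rfl⟩
    · rintro ⟨b, h, rfl⟩
      exact ⟨⟨b, rfl⟩, h⟩
  rw [this, Set.ncard_image_of_injective _ hinj, Set.ncard_coe_finset]

/-- The parameters of a code whose nonzero weights are `W + S * t` for the `t` in a table. -/
theorem parameters_of_enumerator [Finite F] (T : E →ₗ[F] ι → F) (W S t₀ : ℚ)
    {rows : List (ℚ × ℚ)}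
    (hT : ∀ f : ℚ → ℚ, ∑ b, f (hammingNorm (T b)) =
      f 0 + (rows.map fun r => r.2 * f (W + S * r.1)).sum)
    (hS : 0 < S) (hpos : ∀ r ∈ rows, 0 < r.2) (ht₀ : t₀ ∈ rows.map Prod.fst)
    (hle : ∀ r ∈ rows, t₀ ≤ r.1) (hW : 0 < W + S * t₀) :
    Module.finrank F (LinearMap.range T) = Module.finrank F E ∧
    IsMinDistance (LinearMap.range T) (W + S * t₀) ∧
    IsTWeight (LinearMap.range T) (rows.map Prod.fst).toFinset.card ∧
    HasWeightDistribution (LinearMap.range T)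
      ((0, 1) :: rows.map fun r => (W + S * r.1, r.2)) := by
  have hle' : ∀ r ∈ rows.map (fun r : ℚ × ℚ => (W + S * r.1, r.2)), W + S * t₀ ≤ r.1 := by
    intro r hr
    obtain ⟨p, hp, rfl⟩ := List.mem_map.1 hr
    have := mul_le_mul_of_nonneg_left (hle p hp) hS.le
    simpa using this
  have hpos' : ∀ r ∈ rows.map (fun r : ℚ × ℚ => (W + S * r.1, r.2)), 0 < r.2 := by
    intro r hr
    obtain ⟨p, hp, rfl⟩ := List.mem_map.1 hr
    exact hpos p hp
  have hw' : ∀ r ∈ rows.map (fun r : ℚ × ℚ => (W + S * r.1, r.2)), 0 < r.1 :=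
    fun r hr => hW.trans_le (hle' r hr)
  obtain ⟨hinj, hdist⟩ := hasWeightDistribution_range T
    (rows := rows.map (fun r : ℚ × ℚ => (W + S * r.1, r.2)))
    (by intro f; rw [hT f]; simp [Function.comp_def]) hw'
  refine ⟨LinearMap.finrank_range_of_inj hinj,
    isMinDistance_of_hasWeightDistribution hdist hpos' hW ?_ hle', ?_, hdist⟩
  · obtain ⟨p, hp, hpe⟩ := List.mem_map.1 ht₀
    rw [List.map_map]
    exact List.mem_map.2 ⟨p, hp, by simp [hpe]⟩
  · have h := isTWeight_of_hasWeightDistribution hdist hpos' hw'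
    have hcard : ((rows.map (fun r : ℚ × ℚ => (W + S * r.1, r.2))).map Prod.fst).toFinset.card =
        (rows.map Prod.fst).toFinset.card := by
      have hinj' : Function.Injective fun t : ℚ => W + S * t := fun a b h =>
        mul_left_cancel₀ hS.ne' (add_left_cancel h)
      rw [← card_image_of_injective (rows.map Prod.fst).toFinset hinj']
      congr 1
      ext w
      simp only [List.mem_toFinset, mem_image, List.mem_map]
      constructor
      · rintro ⟨-, ⟨p, hp, rfl⟩, rfl⟩
        exact ⟨p.1, ⟨p, hp, rfl⟩, rfl⟩
      · rintro ⟨-, ⟨p, hp, rfl⟩, rfl⟩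
        exact ⟨_, ⟨p, hp, rfl⟩, rfl⟩
    rwa [hcard] at h

end CodeParameters

/-! ### The three weight enumerators. -/

section Enumerators

variable {F V : Type*} [Field F] [Fintype F] [DecidableEq F]
  [AddCommGroup V] [Module F V] [Fintype V]

open Classical in
/-- The size of the section and the weight enumerator for `B w₀ w₀ ≠ 0` and
`v ^ 2 ≠ u * B w₀ w₀`. -/
theorem enumerator_nondegenerate [Fintype (Module.Dual F V)] (hF : ringChar F ≠ 2)
    (B : LinearMap.BilinForm F V) (hB : ∀ x y, B x y = B y x) (q E X : ℚ)
    (hq : q = Fintype.card F) (hE : E ≠ 0) (hrad : (#{x | B x = 0} : ℚ) = E)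
    (hV : (Fintype.card V : ℚ) = E * X ^ 2 * q ^ 4)
    (hN : ∀ c : F, (#{x | B x x = c} : ℚ) = Fintype.card V / Fintype.card F + E * X * q
      - (if c = 0 then Fintype.card F * (E * X * q) else 0))
    (w₀ : V) (hw₀ : B w₀ ≠ 0) (u v : F) (hv : v ≠ 0) (ha : B w₀ w₀ ≠ 0)
    (hΔ : v ^ 2 - u * B w₀ w₀ ≠ 0) (η : ℚ) (hη : η = quadraticChar F (v ^ 2 - u * B w₀ w₀)) :
    (#{x | B x x = u ∧ B w₀ x = v} : ℚ) = E * X ^ 2 * q ^ 2 - E * X * q * η ∧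
    ∀ f : ℚ → ℚ, ∑ φ, f (sectionWeight B w₀ u v φ) =
      f 0 + ([ (0, X ^ 2 * q ^ 2 - 1),
        (-η, (q - 1) * (X ^ 2 * q ^ 2 - X * q * η)),
        (-q * η, (q - 1) * (X ^ 2 * q ^ 2 - 1)),
        (X * q - q * η, q - 1),
        (-q * η + 1, (q - 1) / 2 * ((η - 1) * (X * q + X ^ 2 * q ^ 2) + X * q ^ 2)
          + 1 / 2 * (E * X ^ 2 * q ^ 4 * (η + 1) - X ^ 2 * q ^ 3 - X ^ 2 * q ^ 4 * η)),
        (-q * η - 1, (q - 1) / 2 * ((η + 1) * (X * q - X ^ 2 * q ^ 2) - X * q ^ 2)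
          + 1 / 2 * (E * X ^ 2 * q ^ 4 * (1 - η) + X ^ 2 * q ^ 4 * η - X ^ 2 * q ^ 3)) ].map
        fun r : ℚ × ℚ => r.2 * f ((q - 1) * (E * X ^ 2 * q) + E * X * r.1)).sum := by
  have hq0 : q ≠ 0 := by rw [hq]; exact_mod_cast Fintype.card_ne_zero
  have hη1 : η = 1 ∨ η = -1 := by
    rw [hη]
    rcases quadraticChar_dichotomy hΔ with h | h <;> simp [h]
  have hn : (#{x | B x x = u ∧ B w₀ x = v} : ℚ) = E * X ^ 2 * q ^ 2 - E * X * q * η := by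
    rw [card_quadric_inter_hyperplane (Ring.two_ne_zero hF) B hB _ hN w₀ hw₀ v u, ← rootCount,
      rootCount_of_ne_zero hF ha, mul_comm (B w₀ w₀), ← hη, hV, ← hq]
    field_simp
    ring
  refine ⟨hn, fun f => ?_⟩
  rw [mul_comm u] at hΔ hη
  set n : ℚ := E * X ^ 2 * q ^ 2 - E * X * q * η with hnn
  obtain ⟨H, hH⟩ : ∃ H : ℚ → ℚ, ∀ M, H M =
      f (n - E * X ^ 2 * q ^ 2 / q - E * X * q + E * X * q / q * M) := ⟨_, fun _ => rfl⟩
  have key := radical_mul_sum_sectionWeight hF B hB _ hN w₀ hw₀ u v hv f n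
    (E * X ^ 2 * q ^ 2) q hn.symm hq (by rw [hV]; field_simp) H hH
  rw [sum_conic_nondegenerate hF ha hv hΔ _ _ H q hq η hη, sum_conic_line hF ha hv H q hq, ← hη,
    hrad, hV] at key
  -- Here t is the offset of the weight from (q − 1)EX²q in units of EX.
  have e : ∀ M t : ℚ, M = t + q + q * η →
      H M = f ((q - 1) * (E * X ^ 2 * q) + E * X * t) := by
    intro M t h
    rw [hH, h, hnn]
    congr 1
    field_simp
    ring
  have en : f n = f ((q - 1) * (E * X ^ 2 * q) + E * X * (X * q - q * η)) := by
    congr 1; rw [hnn]; ring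
  have ew : f ((q - 1) / q * n) = f ((q - 1) * (E * X ^ 2 * q) + E * X * (-q * η + η)) := by
    congr 1; rw [hnn]; field_simp; ring
  rw [en, ew, e (q + q * η) 0 (by ring), e q (-q * η) (by ring),
    e (q - 1) (-q * η - 1) (by ring), e (q + 1) (-q * η + 1) (by ring),
    e (q + (q - 1) * η) (-η) (by ring), e (q - η) (-q * η - η) (by ring)] at key
  simp only [List.map_cons, List.map_nil, List.sum_cons, List.sum_nil]
  refine mul_left_cancel₀ hE (key.trans ?_)
  -- Functionals not represented by B have offset −qη + η, and some conics have offset −qη − η.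
  -- Which of these equals −qη + 1 and which −qη − 1 depends on η, so rows merge differently for the
  -- two signs.
  rcases hη1 with h | h
  · simp only [h]
    ring
  · simp only [h]
    norm_num only [sub_neg_eq_add, ← sub_eq_add_neg]
    ring

open Classical in
/-- The size of the section and the weight enumerator for `v ^ 2 = u * B w₀ w₀`. -/
theorem enumerator_tangent [Fintype (Module.Dual F V)] (hF : ringChar F ≠ 2)
    (B : LinearMap.BilinForm F V) (hB : ∀ x y, B x y = B y x) (q E X : ℚ)
    (hq : q = Fintype.card F) (hE : E ≠ 0) (hrad : (#{x | B x = 0} : ℚ) = E)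
    (hV : (Fintype.card V : ℚ) = E * X ^ 2 * q ^ 4)
    (hN : ∀ c : F, (#{x | B x x = c} : ℚ) = Fintype.card V / Fintype.card F + E * X * q
      - (if c = 0 then Fintype.card F * (E * X * q) else 0))
    (w₀ : V) (hw₀ : B w₀ ≠ 0) (u v : F) (hv : v ≠ 0) (hΔ : v ^ 2 - u * B w₀ w₀ = 0) :
    (#{x | B x x = u ∧ B w₀ x = v} : ℚ) = E * X ^ 2 * q ^ 2 ∧
    ∀ f : ℚ → ℚ, ∑ φ, f (sectionWeight B w₀ u v φ) =
      f 0 + ([ (0, E * X ^ 2 * q ^ 4 - X ^ 2 * q ^ 4 + X ^ 2 * q ^ 3 - q),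
        (-1, (q - 1) ^ 2 / 2 * (X ^ 2 * q ^ 2 - X * q)),
        (1, (q - 1) ^ 2 / 2 * (X ^ 2 * q ^ 2 + X * q)),
        (X * q, q - 1),
        (q - 1, (q - 1) / 2 * (X ^ 2 * q ^ 2 - X * q)),
        (1 - q, (q - 1) / 2 * (X ^ 2 * q ^ 2 + X * q)) ].map
        fun r : ℚ × ℚ => r.2 * f ((q - 1) * (E * X ^ 2 * q) + E * X * r.1)).sum := by
  have hq0 : q ≠ 0 := by rw [hq]; exact_mod_cast Fintype.card_ne_zero
  have ha : B w₀ w₀ ≠ 0 := by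
    intro h
    rw [h, mul_zero, sub_zero] at hΔ
    exact pow_ne_zero 2 hv hΔ
  have hn : (#{x | B x x = u ∧ B w₀ x = v} : ℚ) = E * X ^ 2 * q ^ 2 := by
    rw [card_quadric_inter_hyperplane (Ring.two_ne_zero hF) B hB _ hN w₀ hw₀ v u, ← rootCount,
      rootCount_of_ne_zero hF ha, mul_comm (B w₀ w₀), hΔ, hV, ← hq, quadraticChar_zero]
    push_cast
    field_simp
    ring
  refine ⟨hn, fun f => ?_⟩
  rw [mul_comm u] at hΔ
  obtain ⟨H, hH⟩ : ∃ H : ℚ → ℚ, ∀ M, H M = f (E * X ^ 2 * q ^ 2 - E * X ^ 2 * q ^ 2 / q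
      - E * X * q + E * X * q / q * M) := ⟨_, fun _ => rfl⟩
  have key := radical_mul_sum_sectionWeight hF B hB _ hN w₀ hw₀ u v hv f (E * X ^ 2 * q ^ 2)
    (E * X ^ 2 * q ^ 2) q hn.symm hq (by rw [hV]; field_simp) H hH
  rw [sum_conic_tangent hF ha hv hΔ _ _ H q hq, sum_conic_line hF ha hv H q hq, hΔ,
    quadraticChar_zero, Int.cast_zero, hrad, hV] at key
  have e : ∀ M t : ℚ, M = t + q → H M = f ((q - 1) * (E * X ^ 2 * q) + E * X * t) := by
    intro M t h
    rw [hH, h]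
    congr 1
    field_simp
    ring
  have en : f (E * X ^ 2 * q ^ 2) = f ((q - 1) * (E * X ^ 2 * q) + E * X * (X * q)) := by
    congr 1; ring
  -- The functionals not represented by B contribute to the row of offset 0.
  have ew : f ((q - 1) / q * (E * X ^ 2 * q ^ 2)) =
      f ((q - 1) * (E * X ^ 2 * q) + E * X * 0) := by
    congr 1; field_simp; ring
  rw [en, ew, e (q + q * 0) 0 (by ring), e q 0 (by ring), e (q - 1) (-1) (by ring),
    e (q + 1) 1 (by ring), e (2 * q - 1) (q - 1) (by ring), e 1 (1 - q) (by ring)] at key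
  simp only [List.map_cons, List.map_nil, List.sum_cons, List.sum_nil]
  refine mul_left_cancel₀ hE (key.trans ?_)
  ring

open Classical in
/-- The size of the section and the weight enumerator for `B w₀ w₀ = 0`. -/
theorem enumerator_isotropic [Fintype (Module.Dual F V)] (hF : ringChar F ≠ 2)
    (B : LinearMap.BilinForm F V) (hB : ∀ x y, B x y = B y x) (q E X : ℚ)
    (hq : q = Fintype.card F) (hE : E ≠ 0) (hrad : (#{x | B x = 0} : ℚ) = E)
    (hV : (Fintype.card V : ℚ) = E * X ^ 2 * q ^ 4)
    (hN : ∀ c : F, (#{x | B x x = c} : ℚ) = Fintype.card V / Fintype.card F + E * X * q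
      - (if c = 0 then Fintype.card F * (E * X * q) else 0))
    (w₀ : V) (hw₀ : B w₀ ≠ 0) (u v : F) (hv : v ≠ 0) (ha : B w₀ w₀ = 0) :
    (#{x | B x x = u ∧ B w₀ x = v} : ℚ) = E * X ^ 2 * q ^ 2 ∧
    ∀ f : ℚ → ℚ, ∑ φ, f (sectionWeight B w₀ u v φ) =
      f 0 + ([ (0, E * X ^ 2 * q ^ 4 - X ^ 2 * q ^ 4 + X ^ 2 * q ^ 3 - q),
        (X * q, q - 1),
        (-1, (q - 1) * (X ^ 2 * q ^ 3 - X ^ 2 * q ^ 2)),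
        (q - 1, (q - 1) * (X ^ 2 * q ^ 2)) ].map
        fun r : ℚ × ℚ => r.2 * f ((q - 1) * (E * X ^ 2 * q) + E * X * r.1)).sum := by
  have h2 : (2 : F) ≠ 0 := Ring.two_ne_zero hF
  have hq0 : q ≠ 0 := by rw [hq]; exact_mod_cast Fintype.card_ne_zero
  have hn : (#{x | B x x = u ∧ B w₀ x = v} : ℚ) = E * X ^ 2 * q ^ 2 := by
    rw [card_quadric_inter_hyperplane h2 B hB _ hN w₀ hw₀ v u, ← rootCount, ha,
      rootCount_zero_of_ne_zero h2 hv, hV, ← hq]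
    push_cast
    field_simp
    ring
  refine ⟨hn, fun f => ?_⟩
  obtain ⟨H, hH⟩ : ∃ H : ℚ → ℚ, ∀ M, H M = f (E * X ^ 2 * q ^ 2 - E * X ^ 2 * q ^ 2 / q
      - E * X * q + E * X * q / q * M) := ⟨_, fun _ => rfl⟩
  have key := radical_mul_sum_sectionWeight hF B hB _ hN w₀ hw₀ u v hv f (E * X ^ 2 * q ^ 2)
    (E * X ^ 2 * q ^ 2) q hn.symm hq (by rw [hV]; field_simp) H hH
  rw [ha, sum_conic_isotropic hF hv _ _ H q hq, sum_conic_line_isotropic hF hv H q hq, hrad,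
    hV] at key
  have e : ∀ M t : ℚ, M = t + q → H M = f ((q - 1) * (E * X ^ 2 * q) + E * X * t) := by
    intro M t h
    rw [hH, h]
    congr 1
    field_simp
    ring
  have en : f (E * X ^ 2 * q ^ 2) = f ((q - 1) * (E * X ^ 2 * q) + E * X * (X * q)) := by
    congr 1; ring
  have ew : f ((q - 1) / q * (E * X ^ 2 * q ^ 2)) =
      f ((q - 1) * (E * X ^ 2 * q) + E * X * 0) := by
    congr 1; field_simp; ring
  rw [en, ew, e q 0 (by ring), e (q - 1) (-1) (by ring), e (2 * q - 1) (q - 1) (by ring)] at key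
  simp only [List.map_cons, List.map_nil, List.sum_cons, List.sum_nil]
  refine mul_left_cancel₀ hE (key.trans ?_)
  ring

end Enumerators

/-! ### From the trace code to functionals on the section. -/

section TraceCodeEnumerator

variable {F L : Type*} [Field F] [Fintype F] [DecidableEq F] [Field L] [Fintype L]
  [DecidableEq L] [Algebra F L]

/-- The condition x ≠ 0 is automatic, because Tr x = v ≠ 0. -/
theorem defSet₁_eq (hF : ringChar F ≠ 2) (e : ℕ) (u : F) {v : F} (hv : v ≠ 0) :
    defSet₁ e u v =
      ({x | weilForm F L e x x = u ∧ weilForm F L e 1 x = v} : Finset L) := by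
  have h2 : (2 : F) ≠ 0 := Ring.two_ne_zero hF
  ext x
  simp only [defSet₁, mem_filter, mem_univ, true_and, weilForm_self h2, weilForm_one h2,
    and_iff_right_iff_imp]
  rintro ⟨-, h⟩ rfl
  exact hv (by rw [← h, map_zero])

/-- The weights of the trace code are the weights of the functionals on the section. -/
theorem sum_hammingNorm_traceCode [Fintype (Module.Dual F L)] (hF : ringChar F ≠ 2) (e : ℕ)
    (u : F) {v : F} (hv : v ≠ 0) (f : ℚ → ℚ) :
    ∑ b : L, f (hammingNorm ((LinearMap.pi fun d : (defSet₁ e u v : Finset L) =>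
      (Algebra.trace F L).comp (LinearMap.mulRight F (d : L))) b)) =
    ∑ φ, f (sectionWeight (weilForm F L e) 1 u v φ) := by
  -- By nondegeneracy of the trace form, b ↦ Tr(b ·) is a bijection onto the dual.
  refine Fintype.sum_equiv (LinearMap.BilinForm.toDual (Algebra.traceForm F L)
    (traceForm_nondegenerate F L)).toEquiv _ _ fun b => ?_
  congr 2
  rw [hammingNorm, sectionWeight, ← filter_filter, ← defSet₁_eq hF e u hv]
  refine card_bij (fun d _ => (d : L)) ?_ ?_ ?_
  · intro d hd
    simp only [mem_filter, mem_univ, true_and] at hd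
    exact mem_filter.2 ⟨d.2, hd⟩
  · intro d _ d' _ h
    exact Subtype.ext h
  · intro x hx
    obtain ⟨hx1, hx2⟩ := mem_filter.1 hx
    exact ⟨⟨x, hx1⟩, mem_filter.2 ⟨mem_univ _, hx2⟩, rfl⟩

end TraceCodeEnumerator

/-! ### Positivity of frequencies and coincidences between weights. -/

section Tables

theorem frequencies_nondegenerate_pos {q E X : ℚ} {η : ℤ} (hq : 3 ≤ q) (hE : 1 ≤ E)
    (hX : 1 ≤ X) (hη : η = 1 ∨ η = -1) :
    ∀ r ∈ ([ (0, X ^ 2 * q ^ 2 - 1),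
        (-η, (q - 1) * (X ^ 2 * q ^ 2 - X * q * η)),
        (-q * η, (q - 1) * (X ^ 2 * q ^ 2 - 1)),
        (X * q - q * η, q - 1),
        (-q * η + 1, (q - 1) / 2 * ((η - 1) * (X * q + X ^ 2 * q ^ 2) + X * q ^ 2)
          + 1 / 2 * (E * X ^ 2 * q ^ 4 * (η + 1) - X ^ 2 * q ^ 3 - X ^ 2 * q ^ 4 * η)),
        (-q * η - 1, (q - 1) / 2 * ((η + 1) * (X * q - X ^ 2 * q ^ 2) - X * q ^ 2)
          + 1 / 2 * (E * X ^ 2 * q ^ 4 * (1 - η) + X ^ 2 * q ^ 4 * η - X ^ 2 * q ^ 3)) ] :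
        List (ℚ × ℚ)), 0 < r.2 := by
  -- Expanded in q − 3, E − 1 and X − 1, the frequencies have nonnegative coefficients and a
  -- positive constant term.
  obtain ⟨q', hq', rfl⟩ : ∃ q', 0 ≤ q' ∧ q = q' + 3 := ⟨q - 3, by linarith, by ring⟩
  obtain ⟨E', hE', rfl⟩ : ∃ E', 0 ≤ E' ∧ E = E' + 1 := ⟨E - 1, by linarith, by ring⟩
  obtain ⟨X', hX', rfl⟩ : ∃ X', 0 ≤ X' ∧ X = X' + 1 := ⟨X - 1, by linarith, by ring⟩
  simp only [List.mem_cons, List.not_mem_nil, or_false, forall_eq_or_imp, forall_eq]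
  rcases hη with rfl | rfl <;> push_cast <;>
  refine ⟨?_, ?_, ?_, ?_, ?_, ?_⟩ <;> ring_nf <;> positivity

/-- With Y = Xq, the only possible coincidence is 0 = Y − qη, which needs η = 1 and X = 1. -/
theorem card_offsets_nondegenerate {q Y : ℚ} {η : ℤ} (hq : 3 ≤ q) (hY : q ≤ Y)
    (hη : η = 1 ∨ η = -1) :
    ([0, -η, -q * η, Y - q * η, -q * η + 1, -q * η - 1] : List ℚ).toFinset.card =
      if Y = q ∧ η = 1 then 5 else 6 := by
  rcases hη with rfl | rfl
  · push_cast
    simp only [mul_one, and_true]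
    split_ifs with hYq
    · rw [hYq, show ([0, -1, -q, q - q, -q + 1, -q - 1] : List ℚ).toFinset =
        ([0, -1, -q, -q + 1, -q - 1] : List ℚ).toFinset by
          ext t
          simp only [List.mem_toFinset, List.mem_cons, List.not_mem_nil, or_false, sub_self]
          tauto, List.toFinset_card_of_nodup]
      · rfl
      · simp only [List.nodup_cons, List.mem_cons, List.not_mem_nil, or_false, not_or,
          List.nodup_nil, not_false_eq_true, and_true]
        refine ⟨⟨?_, ?_, ?_, ?_⟩, ⟨?_, ?_, ?_⟩, ⟨?_, ?_⟩, ?_⟩ <;> intro h <;> linarith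
    · have hlt : q < Y := lt_of_le_of_ne hY (Ne.symm hYq)
      rw [List.toFinset_card_of_nodup]
      · rfl
      · simp only [List.nodup_cons, List.mem_cons, List.not_mem_nil, or_false, not_or,
          List.nodup_nil, not_false_eq_true, and_true]
        refine ⟨⟨?_, ?_, ?_, ?_, ?_⟩, ⟨?_, ?_, ?_, ?_⟩, ⟨?_, ?_, ?_⟩, ⟨?_, ?_⟩, ?_⟩ <;>
          intro h <;> linarith
  · rw [if_neg (by norm_num), List.toFinset_card_of_nodup]
    · rfl
    · push_cast
      simp only [List.nodup_cons, List.mem_cons, List.not_mem_nil, or_false, not_or,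
        List.nodup_nil, not_false_eq_true, and_true]
      refine ⟨⟨?_, ?_, ?_, ?_, ?_⟩, ⟨?_, ?_, ?_, ?_⟩, ⟨?_, ?_, ?_⟩, ⟨?_, ?_⟩, ?_⟩ <;>
        intro h <;> linarith

variable {F ι V : Type*} [Field F] [Finite F] [DecidableEq F] [Fintype ι]
  [AddCommGroup V] [Module F V] [Fintype V]

theorem parameters_nondegenerate (T : V →ₗ[F] ι → F) {q E X : ℚ} {η : ℤ} (hq : 3 ≤ q)
    (hE : 1 ≤ E) (hX1 : 1 ≤ X) (hη : η = 1 ∨ η = -1)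
    (hT : ∀ f : ℚ → ℚ, ∑ b, f (hammingNorm (T b)) =
      f 0 + (([ (0, X ^ 2 * q ^ 2 - 1),
        (-η, (q - 1) * (X ^ 2 * q ^ 2 - X * q * η)),
        (-q * η, (q - 1) * (X ^ 2 * q ^ 2 - 1)),
        (X * q - q * η, q - 1),
        (-q * η + 1, (q - 1) / 2 * ((η - 1) * (X * q + X ^ 2 * q ^ 2) + X * q ^ 2)
          + 1 / 2 * (E * X ^ 2 * q ^ 4 * (η + 1) - X ^ 2 * q ^ 3 - X ^ 2 * q ^ 4 * η)),
        (-q * η - 1, (q - 1) / 2 * ((η + 1) * (X * q - X ^ 2 * q ^ 2) - X * q ^ 2)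
          + 1 / 2 * (E * X ^ 2 * q ^ 4 * (1 - η) + X ^ 2 * q ^ 4 * η - X ^ 2 * q ^ 3)) ] : List (ℚ × ℚ)).map
        fun r : ℚ × ℚ => r.2 * f ((q - 1) * (E * X ^ 2 * q) + E * X * r.1)).sum) :
    Module.finrank F (LinearMap.range T) = Module.finrank F V ∧
    IsMinDistance (LinearMap.range T)
      ((q - 1) * (E * X ^ 2 * q) - (if η = 1 then E * X * q + E * X else 0)) ∧
    IsTWeight (LinearMap.range T) (if X = 1 ∧ η = 1 then 5 else 6) ∧
    HasWeightDistribution (LinearMap.range T)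
      [ (0, 1),
        ((q - 1) * (E * X ^ 2 * q), X ^ 2 * q ^ 2 - 1),
        ((q - 1) * (E * X ^ 2 * q) - E * X * η, (q - 1) * (X ^ 2 * q ^ 2 - X * q * η)),
        ((q - 1) * (E * X ^ 2 * q) - E * X * q * η, (q - 1) * (X ^ 2 * q ^ 2 - 1)),
        (E * X ^ 2 * q ^ 2 - E * X * q * η, q - 1),
        ((q - 1) * (E * X ^ 2 * q) - E * X * q * η + E * X,
          (q - 1) / 2 * ((η - 1) * (X * q + X ^ 2 * q ^ 2) + X * q ^ 2)
          + 1 / 2 * (E * X ^ 2 * q ^ 4 * (η + 1) - X ^ 2 * q ^ 3 - X ^ 2 * q ^ 4 * η)),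
        ((q - 1) * (E * X ^ 2 * q) - E * X * q * η - E * X,
          (q - 1) / 2 * ((η + 1) * (X * q - X ^ 2 * q ^ 2) - X * q ^ 2)
          + 1 / 2 * (E * X ^ 2 * q ^ 4 * (1 - η) + X ^ 2 * q ^ 4 * η - X ^ 2 * q ^ 3)) ] := by
  have hS : 0 < E * X := mul_pos (by linarith) (by linarith)
  have hXq : q ≤ X * q := le_mul_of_one_le_left (by linarith) hX1
  -- This makes the smallest weight positive when its offset is −q − 1.
  have hqXq : q < (q - 1) * (X * q) - 1 := by nlinarith
  obtain ⟨h1, h2, h3, h4⟩ := parameters_of_enumerator T _ _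
    (if η = 1 then -q - 1 else 0) hT hS
    (frequencies_nondegenerate_pos hq hE hX1 hη)
    (by rcases hη with rfl | rfl <;> simp)
    (by
      simp only [List.mem_cons, List.not_mem_nil, or_false, forall_eq_or_imp, forall_eq]
      rcases hη with rfl | rfl
      · rw [if_pos rfl]
        push_cast
        refine ⟨?_, ?_, ?_, ?_, ?_, ?_⟩ <;> linarith
      · rw [if_neg (by norm_num)]
        push_cast
        refine ⟨?_, ?_, ?_, ?_, ?_, ?_⟩ <;> linarith)
    (by
      rw [show (q - 1) * (E * X ^ 2 * q) + E * X * (if η = 1 then -q - 1 else 0) =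
        E * X * ((q - 1) * (X * q) + if η = 1 then -q - 1 else 0) by ring]
      refine mul_pos hS ?_
      split_ifs <;> linarith)
  refine ⟨h1, ?_, ?_, ?_⟩
  · convert h2 using 1
    split_ifs <;> ring
  · convert h3 using 1
    have hcard := card_offsets_nondegenerate hq hXq hη
    simp only [mul_eq_right₀ (show q ≠ 0 by linarith)] at hcard
    exact hcard.symm
  · convert h4 using 1
    simp only [List.map_cons, List.map_nil, List.cons.injEq, Prod.mk.injEq, and_true, true_and]
    refine ⟨?_, ?_, ?_, ?_, ?_, ?_⟩ <;> ring

theorem parameters_tangent (T : V →ₗ[F] ι → F) {q E X : ℚ} (hq : 3 ≤ q)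
    (hE : 1 ≤ E) (hX1 : 1 ≤ X)
    (hT : ∀ f : ℚ → ℚ, ∑ b, f (hammingNorm (T b)) =
      f 0 + (([ (0, E * X ^ 2 * q ^ 4 - X ^ 2 * q ^ 4 + X ^ 2 * q ^ 3 - q),
        (-1, (q - 1) ^ 2 / 2 * (X ^ 2 * q ^ 2 - X * q)),
        (1, (q - 1) ^ 2 / 2 * (X ^ 2 * q ^ 2 + X * q)),
        (X * q, q - 1),
        (q - 1, (q - 1) / 2 * (X ^ 2 * q ^ 2 - X * q)),
        (1 - q, (q - 1) / 2 * (X ^ 2 * q ^ 2 + X * q)) ] : List (ℚ × ℚ)).map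
        fun r : ℚ × ℚ => r.2 * f ((q - 1) * (E * X ^ 2 * q) + E * X * r.1)).sum) :
    Module.finrank F (LinearMap.range T) = Module.finrank F V ∧
    IsMinDistance (LinearMap.range T) ((q - 1) * (E * X ^ 2 * q - E * X)) ∧
    IsTWeight (LinearMap.range T) 6 ∧
    HasWeightDistribution (LinearMap.range T)
      [ (0, 1),
        ((q - 1) * (E * X ^ 2 * q), E * X ^ 2 * q ^ 4 - X ^ 2 * q ^ 4 + X ^ 2 * q ^ 3 - q),
        ((q - 1) * (E * X ^ 2 * q) - E * X, (q - 1) ^ 2 / 2 * (X ^ 2 * q ^ 2 - X * q)),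
        ((q - 1) * (E * X ^ 2 * q) + E * X, (q - 1) ^ 2 / 2 * (X ^ 2 * q ^ 2 + X * q)),
        (E * X ^ 2 * q ^ 2, q - 1),
        ((q - 1) * (E * X ^ 2 * q + E * X), (q - 1) / 2 * (X ^ 2 * q ^ 2 - X * q)),
        ((q - 1) * (E * X ^ 2 * q - E * X), (q - 1) / 2 * (X ^ 2 * q ^ 2 + X * q)) ] := by
  have hS : 0 < E * X := mul_pos (by linarith) (by linarith)
  have hXq : q ≤ X * q := le_mul_of_one_le_left (by linarith) hX1
  obtain ⟨q', hq', rfl⟩ : ∃ q', 0 ≤ q' ∧ q = q' + 3 := ⟨q - 3, by linarith, by ring⟩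
  obtain ⟨E', hE', rfl⟩ : ∃ E', 0 ≤ E' ∧ E = E' + 1 := ⟨E - 1, by linarith, by ring⟩
  obtain ⟨X', hX', rfl⟩ : ∃ X', 0 ≤ X' ∧ X = X' + 1 := ⟨X - 1, by linarith, by ring⟩
  obtain ⟨h1, h2, h3, h4⟩ := parameters_of_enumerator T _ _ (1 - (q' + 3)) hT hS
    (by
      simp only [List.mem_cons, List.not_mem_nil, or_false, forall_eq_or_imp, forall_eq]
      refine ⟨?_, ?_, ?_, ?_, ?_, ?_⟩ <;> ring_nf <;> positivity)
    (by simp)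
    (by
      simp only [List.mem_cons, List.not_mem_nil, or_false, forall_eq_or_imp, forall_eq]
      refine ⟨?_, ?_, ?_, ?_, ?_, ?_⟩ <;> linarith)
    (by ring_nf; positivity)
  refine ⟨h1, ?_, ?_, ?_⟩
  · convert h2 using 1
    ring
  · convert h3 using 1
    rw [List.toFinset_card_of_nodup]
    · rfl
    · simp only [List.map_cons, List.map_nil, List.nodup_cons, List.mem_cons, List.not_mem_nil,
        or_false, not_or, List.nodup_nil, not_false_eq_true, and_true]
      refine ⟨⟨?_, ?_, ?_, ?_, ?_⟩, ⟨?_, ?_, ?_, ?_⟩, ⟨?_, ?_, ?_⟩, ⟨?_, ?_⟩, ?_⟩ <;> intro h <;>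
        linarith
  · convert h4 using 1
    simp only [List.map_cons, List.map_nil, List.cons.injEq, Prod.mk.injEq, and_true, true_and]
    refine ⟨?_, ?_, ?_, ?_, ?_, ?_⟩ <;> ring

theorem parameters_isotropic (T : V →ₗ[F] ι → F) {q E X : ℚ} (hq : 3 ≤ q)
    (hE : 1 ≤ E) (hX1 : 1 ≤ X)
    (hT : ∀ f : ℚ → ℚ, ∑ b, f (hammingNorm (T b)) =
      f 0 + (([ (0, E * X ^ 2 * q ^ 4 - X ^ 2 * q ^ 4 + X ^ 2 * q ^ 3 - q),
        (X * q, q - 1),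
        (-1, (q - 1) * (X ^ 2 * q ^ 3 - X ^ 2 * q ^ 2)),
        (q - 1, (q - 1) * (X ^ 2 * q ^ 2)) ] : List (ℚ × ℚ)).map
        fun r : ℚ × ℚ => r.2 * f ((q - 1) * (E * X ^ 2 * q) + E * X * r.1)).sum) :
    Module.finrank F (LinearMap.range T) = Module.finrank F V ∧
    IsMinDistance (LinearMap.range T) ((q - 1) * (E * X ^ 2 * q) - E * X) ∧
    IsTWeight (LinearMap.range T) 4 ∧
    HasWeightDistribution (LinearMap.range T)
      [ (0, 1),
        ((q - 1) * (E * X ^ 2 * q), E * X ^ 2 * q ^ 4 - X ^ 2 * q ^ 4 + X ^ 2 * q ^ 3 - q),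
        (E * X ^ 2 * q ^ 2, q - 1),
        ((q - 1) * (E * X ^ 2 * q) - E * X, (q - 1) * (X ^ 2 * q ^ 3 - X ^ 2 * q ^ 2)),
        ((q - 1) * (E * X ^ 2 * q + E * X), (q - 1) * (X ^ 2 * q ^ 2)) ] := by
  have hS : 0 < E * X := mul_pos (by linarith) (by linarith)
  have hXq : q ≤ X * q := le_mul_of_one_le_left (by linarith) hX1
  obtain ⟨q', hq', rfl⟩ : ∃ q', 0 ≤ q' ∧ q = q' + 3 := ⟨q - 3, by linarith, by ring⟩
  obtain ⟨E', hE', rfl⟩ : ∃ E', 0 ≤ E' ∧ E = E' + 1 := ⟨E - 1, by linarith, by ring⟩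
  obtain ⟨X', hX', rfl⟩ : ∃ X', 0 ≤ X' ∧ X = X' + 1 := ⟨X - 1, by linarith, by ring⟩
  obtain ⟨h1, h2, h3, h4⟩ := parameters_of_enumerator T _ _ (-1) hT hS
    (by
      simp only [List.mem_cons, List.not_mem_nil, or_false, forall_eq_or_imp, forall_eq]
      refine ⟨?_, ?_, ?_, ?_⟩ <;> ring_nf <;> positivity)
    (by simp)
    (by
      simp only [List.mem_cons, List.not_mem_nil, or_false, forall_eq_or_imp, forall_eq]
      refine ⟨?_, ?_, ?_, ?_⟩ <;> linarith)
    (by ring_nf; positivity)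
  refine ⟨h1, ?_, ?_, ?_⟩
  · convert h2 using 1
    ring
  · convert h3 using 1
    rw [List.toFinset_card_of_nodup]
    · rfl
    · simp only [List.map_cons, List.map_nil, List.nodup_cons, List.mem_cons, List.not_mem_nil,
        or_false, not_or, List.nodup_nil, not_false_eq_true, and_true]
      refine ⟨⟨?_, ?_, ?_⟩, ⟨?_, ?_⟩, ?_⟩ <;> intro h <;> linarith
  · convert h4 using 1
    simp only [List.map_cons, List.map_nil, List.cons.injEq, Prod.mk.injEq, and_true, true_and]
    refine ⟨?_, ?_, ?_, ?_⟩ <;> ring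

end Tables

end WeilCode

/-! ### Assembly: specialization to w₀ = 1 and conversion of the exponents. -/

theorem theorem2 {F L : Type*} [Field F] [Fintype F] [DecidableEq F]
    [Field L] [Fintype L] [DecidableEq L] [Algebra F L]
    (hodd : ringChar F ≠ 2)
    (q m ℓ e ε : ℕ) (hq : Fintype.card F = q) (hm : Module.finrank F L = m) (hℓ : m = 2 * ℓ)
    (he : 0 < e) (heven : Even (m / Nat.gcd m e)) (hε : ε = WeilCode.epsilon ℓ e)
    (hm3 : 3 < m) (hmε : (m : F) ≠ 0 → 2 * ε + 2 < m)
    (u v : F) (hv : v ≠ 0)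
    (η : ℤ) (hη : η = quadraticChar F (v ^ 2 - u * (m : F)))
    (D : Finset L) (hD : D = WeilCode.defSet₁ e u v)
    (C : Submodule F (D → F)) (hC : C = WeilCode.traceCode F D) :
    -- 1)
    (v ^ 2 - u * (m : F) ≠ 0 → (m : F) ≠ 0 →
      (D.card : ℚ) = q ^ (m - 2) - q ^ (ℓ + ε - 1) * η ∧
      Module.finrank F C = m ∧
      WeilCode.IsMinDistance C
        ((q - 1) * q ^ (m - 3) - (if η = 1 then q ^ (ℓ + ε - 1) + q ^ (ℓ + ε - 2) else 0)) ∧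
      WeilCode.IsTWeight C (if ℓ = ε + 2 ∧ η = 1 then 5 else 6) ∧
      WeilCode.HasWeightDistribution C
        [ (0, 1),
          ((q - 1) * q ^ (m - 3),
            q ^ (m - 2 * ε - 2) - 1),
          ((q - 1) * q ^ (m - 3) - q ^ (ℓ + ε - 2) * η,
            (q - 1) * (q ^ (m - 2 * ε - 2) - q ^ (ℓ - ε - 1) * η)),
          ((q - 1) * q ^ (m - 3) - q ^ (ℓ + ε - 1) * η,
            (q - 1) * (q ^ (m - 2 * ε - 2) - 1)),
          (q ^ (m - 2) - q ^ (ℓ + ε - 1) * η,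
            q - 1),
          ((q - 1) * q ^ (m - 3) - q ^ (ℓ + ε - 1) * η + q ^ (ℓ + ε - 2),
            (q - 1) / 2 * ((η - 1) * (q ^ (ℓ - ε - 1) + q ^ (m - 2 * ε - 2)) + q ^ (ℓ - ε))
              + 1 / 2 * (q ^ m * (η + 1) - q ^ (m - 2 * ε - 1) - q ^ (m - 2 * ε) * η)),
          ((q - 1) * q ^ (m - 3) - q ^ (ℓ + ε - 1) * η - q ^ (ℓ + ε - 2),
            (q - 1) / 2 * ((η + 1) * (q ^ (ℓ - ε - 1) - q ^ (m - 2 * ε - 2)) - q ^ (ℓ - ε))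
              + 1 / 2 * (q ^ m * (1 - η) + q ^ (m - 2 * ε) * η - q ^ (m - 2 * ε - 1))) ]) ∧
    -- 2)
    ((m : F) = 0 →
      D.card = q ^ (m - 2) ∧
      Module.finrank F C = m ∧
      WeilCode.IsMinDistance C ((q - 1) * q ^ (m - 3) - q ^ (ℓ + ε - 2)) ∧
      WeilCode.IsTWeight C 4 ∧
      WeilCode.HasWeightDistribution C
        [ (0, 1),
          ((q - 1) * q ^ (m - 3),
            q ^ m - q ^ (m - 2 * ε) + q ^ (m - 2 * ε - 1) - q),
          (q ^ (m - 2),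
            q - 1),
          ((q - 1) * q ^ (m - 3) - q ^ (ℓ + ε - 2),
            (q - 1) * (q ^ (m - 2 * ε - 1) - q ^ (m - 2 * ε - 2))),
          ((q - 1) * (q ^ (m - 3) + q ^ (ℓ + ε - 2)),
            (q - 1) * q ^ (m - 2 * ε - 2)) ]) ∧
    -- 3)
    (v ^ 2 - u * (m : F) = 0 →
      D.card = q ^ (m - 2) ∧
      Module.finrank F C = m ∧
      WeilCode.IsMinDistance C ((q - 1) * (q ^ (m - 3) - q ^ (ℓ + ε - 2))) ∧
      WeilCode.IsTWeight C 6 ∧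
      WeilCode.HasWeightDistribution C
        [ (0, 1),
          ((q - 1) * q ^ (m - 3),
            q ^ m - q ^ (m - 2 * ε) + q ^ (m - 2 * ε - 1) - q),
          ((q - 1) * q ^ (m - 3) - q ^ (ℓ + ε - 2),
            (q - 1) ^ 2 / 2 * (q ^ (m - 2 * ε - 2) - q ^ (ℓ - ε - 1))),
          ((q - 1) * q ^ (m - 3) + q ^ (ℓ + ε - 2),
            (q - 1) ^ 2 / 2 * (q ^ (m - 2 * ε - 2) + q ^ (ℓ - ε - 1))),
          (q ^ (m - 2),
            q - 1),
          ((q - 1) * (q ^ (m - 3) + q ^ (ℓ + ε - 2)),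
            (q - 1) / 2 * (q ^ (m - 2 * ε - 2) - q ^ (ℓ - ε - 1))),
          ((q - 1) * (q ^ (m - 3) - q ^ (ℓ + ε - 2)),
            (q - 1) / 2 * (q ^ (m - 2 * ε - 2) + q ^ (ℓ - ε - 1))) ]) := by
  classical
  have : Fintype (Module.Dual F L) := @Fintype.ofFinite _ (DFunLike.finite _)
  subst hq hℓ hD hC
  have h2 : (2 : F) ≠ 0 := Ring.two_ne_zero hodd
  have hk : ε + 2 ≤ ℓ := by
    by_cases hm0 : ((2 * ℓ : ℕ) : F) = 0
    · rw [hε]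
      -- If m_p = 0 then ℓ ≠ 2, since m = 4 is nonzero in odd characteristic.
      refine WeilCode.epsilon_add_two_le (by omega) he heven (Or.inl ?_)
      rintro rfl
      refine mul_ne_zero h2 h2 ?_
      rw [← hm0]
      norm_num
    · have := hmε hm0
      omega
  obtain ⟨hrad, hval⟩ := WeilCode.weilForm_radical_and_values hodd hm (by omega) he heven hε
  have hcard : Fintype.card L = Fintype.card F ^ (2 * ℓ) := by
    rw [Module.card_eq_pow_finrank (K := F), hm]
  have h11 := WeilCode.weilForm_one_one (L := L) h2 e
  rw [hm] at h11
  have hw₀ := WeilCode.weilForm_one_ne_zero (L := L) h2 e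
  have hcomm := WeilCode.weilForm_comm (F := F) (L := L) e
  have hD := WeilCode.defSet₁_eq (L := L) hodd e u hv
  have hsum := WeilCode.sum_hammingNorm_traceCode (L := L) hodd e u hv
  obtain ⟨k, rfl⟩ : ∃ k, ℓ = ε + k + 2 := ⟨ℓ - (ε + 2), by omega⟩
  obtain ⟨q, hq⟩ : ∃ q : ℚ, q = Fintype.card F := ⟨_, rfl⟩
  -- E is the size of the radical and |L| = EX²q⁴; the exponent k = ℓ − ε − 2 of X is why ε + 2 ≤ ℓ
  -- is needed.
  obtain ⟨E, hE⟩ : ∃ E : ℚ, E = q ^ (2 * ε) := ⟨_, rfl⟩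
  obtain ⟨X, hX⟩ : ∃ X : ℚ, X = q ^ k := ⟨_, rfl⟩
  have hq3 : 3 ≤ q := by
    have h1 : 1 < Fintype.card F := Fintype.one_lt_card
    obtain ⟨j, hj⟩ := WeilCode.odd_card hodd
    rw [hq]
    exact_mod_cast (by omega : 3 ≤ Fintype.card F)
  have hE1 : 1 ≤ E := by rw [hE]; exact one_le_pow₀ (by linarith)
  have hX1 : 1 ≤ X := by rw [hX]; exact one_le_pow₀ (by linarith)
  have hE0 : E ≠ 0 := by linarith
  have hX1iff : X = 1 ↔ ε + k + 2 = ε + 2 := by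
    rw [hX, pow_eq_one_iff_cases]
    constructor
    · rintro (h | h | h)
      · omega
      · linarith
      · linarith [h.1]
    · intro h
      left
      omega
  have p0 : q ^ (2 * (ε + k + 2)) = E * X ^ 2 * q ^ 4 := by rw [hE, hX]; ring
  have p2 : q ^ (2 * (ε + k + 2) - 2) = E * X ^ 2 * q ^ 2 := by
    rw [show 2 * (ε + k + 2) - 2 = 2 * ε + k * 2 + 2 by omega, hE, hX]; ring
  have p3 : q ^ (2 * (ε + k + 2) - 3) = E * X ^ 2 * q := by
    rw [show 2 * (ε + k + 2) - 3 = 2 * ε + k * 2 + 1 by omega, hE, hX]; ring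
  have p4 : q ^ (ε + k + 2 + ε - 1) = E * X * q := by
    rw [show ε + k + 2 + ε - 1 = 2 * ε + k + 1 by omega, hE, hX]; ring
  have p5 : q ^ (ε + k + 2 + ε - 2) = E * X := by
    rw [show ε + k + 2 + ε - 2 = 2 * ε + k by omega, hE, hX]; ring
  have p6 : q ^ (2 * (ε + k + 2) - 2 * ε - 2) = X ^ 2 * q ^ 2 := by
    rw [show 2 * (ε + k + 2) - 2 * ε - 2 = k * 2 + 2 by omega, hX]; ring
  have p7 : q ^ (2 * (ε + k + 2) - 2 * ε - 1) = X ^ 2 * q ^ 3 := by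
    rw [show 2 * (ε + k + 2) - 2 * ε - 1 = k * 2 + 3 by omega, hX]; ring
  have p8 : q ^ (2 * (ε + k + 2) - 2 * ε) = X ^ 2 * q ^ 4 := by
    rw [show 2 * (ε + k + 2) - 2 * ε = k * 2 + 4 by omega, hX]; ring
  have p9 : q ^ (ε + k + 2 - ε - 1) = X * q := by
    rw [show ε + k + 2 - ε - 1 = k + 1 by omega, hX]; ring
  have p10 : q ^ (ε + k + 2 - ε) = X * q ^ 2 := by
    rw [show ε + k + 2 - ε = k + 2 by omega, hX]; ring
  have hradE := congrArg (Nat.cast : ℕ → ℚ) hrad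
  rw [Nat.cast_pow, ← hq, ← hE] at hradE
  have hV : (Fintype.card L : ℚ) = E * X ^ 2 * q ^ 4 := by
    rw [hcard, Nat.cast_pow, ← hq, p0]
  rw [show (Fintype.card F : ℚ) ^ (ε + k + 2 + ε - 1) = E * X * q by rw [← hq, p4]] at hval
  refine ⟨fun hΔ hm0 => ?_, fun hm0 => ?_, fun hΔ => ?_⟩
  · rw [← h11] at hΔ hm0 hη
    obtain ⟨hn, hf⟩ := WeilCode.enumerator_nondegenerate hodd _ hcomm q E X hq hE0 hradE hV hval 1
      hw₀ u v hv hm0 hΔ η (by rw [hη])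
    have hη1 : η = 1 ∨ η = -1 := by rw [hη]; exact quadraticChar_dichotomy hΔ
    obtain ⟨h1, h3, h4, h5⟩ := WeilCode.parameters_nondegenerate _ hq3 hE1 hX1 hη1
      fun f => (hsum f).trans (hf f)
    rw [hm] at h1
    simp only [Nat.cast_ite, Nat.cast_add, Nat.cast_pow, Nat.cast_zero, ← hq, p0, p2, p3, p4, p5,
      p6, p7, p8, p9, p10]
    simp only [hX1iff] at h4
    exact ⟨by rw [hD]; exact hn, h1, h3, h4, h5⟩
  · rw [← h11] at hm0
    obtain ⟨hn, hf⟩ := WeilCode.enumerator_isotropic hodd _ hcomm q E X hq hE0 hradE hV hval 1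
      hw₀ u v hv hm0
    obtain ⟨h1, h3, h4, h5⟩ := WeilCode.parameters_isotropic _ hq3 hE1 hX1
      fun f => (hsum f).trans (hf f)
    rw [hm] at h1
    rw [← hD, ← p2, hq] at hn
    simp only [← hq, p0, p2, p3, p5, p6, p7, p8]
    exact ⟨by exact_mod_cast hn, h1, h3, h4, h5⟩
  · rw [← h11] at hΔ
    obtain ⟨hn, hf⟩ := WeilCode.enumerator_tangent hodd _ hcomm q E X hq hE0 hradE hV hval 1
      hw₀ u v hv hΔ
    obtain ⟨h1, h3, h4, h5⟩ := WeilCode.parameters_tangent _ hq3 hE1 hX1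
      fun f => (hsum f).trans (hf f)
    rw [hm] at h1
    rw [← hD, ← p2, hq] at hn
    simp only [← hq, p0, p2, p3, p5, p6, p7, p8, p9]
    exact ⟨by exact_mod_cast hn, h1, h3, h4, h5⟩
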